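/- **Setting.** Let $1\le d\le D-1$ be integers, $x\in\mathbb R^D$, $\alpha,\beta\ge 0$, $\tau,L,R>0$, $0\le f_{\min}<f_{\max}$ and $p\ge 1$. For a compact smooth ($C^\infty$) submanifold $M\subset\mathbb R^D$ without boundary and $z\in M$, let $\exp_z:T_zM\to M$ be the exponential map and $\mathrm{inj}_M(z)$ the injectivity radius, i.e. the supremum of the $\varepsilon$ for which $\exp_z$ is a smooth parametrization of $M$ on the open ball $B_{T_zM}(0,\varepsilon)$. For $\gamma>0$ put $k=\lceil\gamma-1\rceil$. A function $f:M\to\mathbb R^m$ belongs to $\mathcal H^\gamma(M,\mathbb R^m)$ with $\|f\|_{\mathcal H^\gamma}\le K$ if for every $z\in M$ the map $f\circ\exp_z$ is $k$ times differentiable on $B_{T_zM}(0,\mathrm{inj}_M(z))$ and $$\|d^k(f\circ\exp_z)(v)-d^k(f\circ\exp_z)(w)\|_{\mathrm{op}}\le K\|v-w\|^{\gamma-k}\qquad\text{for all } v,w\in B_{T_zM}(0,\mathrm{inj}_M(z)).$$ For $\gamma=0$ this is read with $k=0$: $f$ is continuous and $f\circ \exp_z$ has oscillation at most $K$ on that ball.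 The reach $\tau_M$ is the supremum of the $r\ge0$ such that every point of $\mathbb R^D$ at distance at most $r$ from $M$ has a unique nearest point in $M$. Let $\mathcal C_{d,\alpha}(\tau,L)$ be the set of compact smooth $d$-dimensional submanifolds $M$ of $\mathbb R^D$ without boundary such that $x\in M$, $\tau_M\ge\tau$, and the inclusion $\iota_M:M\hookrightarrow\mathbb R^D$ satisfies $\|\iota_M\|_{\mathcal H^{\alpha+1}}\le L$. Let $\mu_M$ be the $d$-dimensional Hausdorff measure restricted to $M$, and let $\Sigma^d_{\alpha,\beta}=\Sigma^d_{\alpha,\beta}(\tau,L,f_{\min},f_{\max},R)$ be the set of Borel probability measures $P$ on $\mathbb R^D$ whose support $M_P$ belongs to $\mathcal C_{d,\alpha}(\tau,L)$ and which have a density $f_P=dP/d\mu_{M_P}$ in $\mathcal H^\beta(M_P,\mathbb R)$ with $f_{\min}\le f_P\le f_{\max}$ on $M_P$ and $\|f_P\|_{\mathcal H^\beta}\le R$. **Theorem (lower bound).** If $L$ and $f_{\max}$ are large enough and $f_{\min}$ is small enough, then $$\liminf_{n\to\infty}\; n^{\beta/(2\beta+d)}\;\inf_{\widehat f(x)}\;\sup_{P\in\Sigma^d_{\alpha,\beta}}\mathbb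 E_{P^{\otimes n}}\bigl[|\widehat f(x)-f_P(x)|^p\bigr]^{1/p}\;\ge\; C_*>0,$$ where the infimum is over all estimators, i.e. all measurable real functions of a sample $(X_1,\dots,X_n)$ drawn from $P^{\otimes n}$. Here, for fixed $d$ and $\beta$, the constant $C_*$ depends only on $\tau$ and $R$; it does not depend on $D,x,\alpha,p,L,f_{\min},f_{\max}$. The thresholds are: $f_{\max}\ge f_{\max}^0$ and $f_{\min}\le f_{\min}^0$ with $f_{\max}^0$ and $f_{\min}^0>0$ depending only on $d$ and $\tau$, and $L\ge L^0$ with $L^0$ depending only on $d$, $\tau$ and $\alpha$. -/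

import Mathlib

open MeasureTheory Filter Topology
open scoped ENNReal NNReal ContDiff

noncomputable section

namespace ManifoldDensity

section Geometry

variable {E : Type*} [NormedAddCommGroup E] [InnerProductSpace ℝ E]

/-- `φ`, restricted to the open set `V`, is a smooth (`C^∞`) parametrization of a relatively open
piece of `M`: a smooth immersion of `V` that is a homeomorphism onto an open subset of `M`. -/
structure IsSmoothParametrization {F : Type*} [NormedAddCommGroup F] [NormedSpace ℝ F]
    (M : Set E) (V : Set F) (φ : F → E) : Prop where
  isOpen_domain : IsOpen V
  smooth : ContDiffOn ℝ ∞ φ V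
  immersion : ∀ v ∈ V, Function.Injective (fderiv ℝ φ v)
  isOpen_image : ∃ U : Set E, IsOpen U ∧ φ '' V = M ∩ U
  continuous_inverse : ∃ ψ : E → F, ContinuousOn ψ (φ '' V) ∧ Set.LeftInvOn ψ φ V

/-- `M` is a smooth embedded submanifold of dimension `d`, without boundary. -/
def IsSmoothSubmanifold (d : ℕ) (M : Set E) : Prop :=
  ∀ p ∈ M, ∃ (V : Set (EuclideanSpace ℝ (Fin d))) (φ : EuclideanSpace ℝ (Fin d) → E),
    IsSmoothParametrization M V φ ∧ p ∈ φ '' V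

/-- The tangent space `T_p M`: the velocities at `p` of smooth curves in `M` through `p`.
(For a smooth submanifold these velocities already form a linear subspace; the span makes it a
`Submodule` by construction.) -/
def tangentSpaceAt (M : Set E) (p : E) : Submodule ℝ E :=
  Submodule.span ℝ {v | ∃ γ : ℝ → E, ContDiffAt ℝ ∞ γ 0 ∧ (∀ᶠ t in 𝓝 (0 : ℝ), γ t ∈ M) ∧
    γ 0 = p ∧ deriv γ 0 = v}

/-- `γ : ℝ → M` is a geodesic of `M` (for the metric induced by the ambient space):
its acceleration is everywhere normal to `M`. -/
structure IsGeodesic (M : Set E) (γ : ℝ → E) : Prop where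
  smooth : ContDiff ℝ ∞ γ
  mem : ∀ t, γ t ∈ M
  normal_acceleration : ∀ t, ∀ w ∈ tangentSpaceAt M (γ t), inner ℝ (deriv (deriv γ) t) w = 0

open Classical in
/-- The exponential map: `exp_p(v) = γ(1)` for the geodesic `γ` with `γ(0) = p`, `γ'(0) = v`.
On a compact smooth submanifold this geodesic exists and is unique for `p ∈ M`, `v ∈ T_p M`;
the default value `p` is then never used. -/
def expMap (M : Set E) (p v : E) : E :=
  if h : ∃ γ : ℝ → E, IsGeodesic M γ ∧ γ 0 = p ∧ deriv γ 0 = v then h.choose 1 else p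

/-- The injectivity radius at `p`: the supremum of all `ε` such that `exp_p` is a smooth
parametrization of `M` on the open ball of radius `ε` of `T_p M`. -/
def injRadius (M : Set E) (p : E) : ℝ≥0∞ :=
  ⨆ (ε : ℝ≥0) (_ : IsSmoothParametrization M (Metric.ball (0 : tangentSpaceAt M p) ε)
    (fun v : tangentSpaceAt M p => expMap M p v)), (ε : ℝ≥0∞)

/-- The open ball of `T_p M` with centre `0` and radius the injectivity radius. -/
def injBall (M : Set E) (p : E) : Set (tangentSpaceAt M p) :=
  {v | (‖v‖₊ : ℝ≥0∞) < injRadius M p}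

/-- `f ∈ H^γ(M, F)` with Hölder coefficient `‖f‖_{H^γ} ≤ K`. With `k = ⌈γ - 1⌉`, for every `p ∈ M`
the map `f ∘ exp_p` is `k` times (continuously) differentiable on the ball of radius `inj_M(p)`,
and its `k`-th differential is `(γ - k)`-Hölder there with constant `K`. (For `γ = 0` the natural
ceiling gives `k = 0`: `f ∘ exp_p` is continuous with oscillation at most `K`.)
Only the values of `f` on `M` matter. -/
structure IsHolderWith {F : Type*} [NormedAddCommGroup F] [NormedSpace ℝ F]
    (M : Set E) (γ K : ℝ) (f : E → F) : Prop where
  contDiffOn : ∀ p ∈ M,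
    ContDiffOn ℝ (⌈γ - 1⌉₊ : ℕ) (fun v : tangentSpaceAt M p => f (expMap M p v)) (injBall M p)
  holder : ∀ p ∈ M, ∀ v ∈ injBall M p, ∀ w ∈ injBall M p,
    ‖iteratedFDeriv ℝ ⌈γ - 1⌉₊ (fun u : tangentSpaceAt M p => f (expMap M p u)) v
      - iteratedFDeriv ℝ ⌈γ - 1⌉₊ (fun u : tangentSpaceAt M p => f (expMap M p u)) w‖
      ≤ K * ‖v - w‖ ^ (γ - (⌈γ - 1⌉₊ : ℝ))

/-- The reach of `K`: the supremum of all `r ≥ 0` such that every point at distance at most `r`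
from `K` has a unique nearest point in `K`. -/
def reach (K : Set E) : ℝ≥0∞ :=
  ⨆ (r : ℝ≥0) (_ : ∀ z : E, Metric.infDist z K ≤ r →
    ∃! y : E, y ∈ K ∧ Metric.infDist z K = dist z y), (r : ℝ≥0∞)

/-- The class `C_{d,α}(τ, L)` of compact smooth `d`-dimensional submanifolds containing the point
`x`, with reach at least `τ`, whose inclusion map is `(α+1)`-Hölder with coefficient at most `L`. -/
structure ManifoldClass (x : E) (d : ℕ) (α τ L : ℝ) (M : Set E) : Prop where
  mem : x ∈ M
  submanifold : IsSmoothSubmanifold d M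
  compact : IsCompact M
  reach_ge : ENNReal.ofReal τ ≤ reach M
  inclusion_holder : IsHolderWith M (α + 1) L (fun y : E => y)

end Geometry

section Model

variable {D : ℕ}

/-- The volume measure `μ_M`: the `d`-dimensional Hausdorff measure (normalized so as to agree with
Lebesgue measure on `d`-dimensional subspaces), restricted to `M`. -/
def volumeMeasure (d : ℕ) (M : Set (EuclideanSpace ℝ (Fin D))) :
    Measure (EuclideanSpace ℝ (Fin D)) :=
  (Measure.euclideanHausdorffMeasure d).restrict M

/-- `P` belongs to `Σ^d_{α,β}(τ, L, f_min, f_max, R)` and `f` is its density `f_P` with respect to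
the volume measure of its support `M_P`. The version `f` is continuous on `M_P`, so its values on
`M_P` are determined by `P`; the values of `f` off `M_P` play no role. -/
structure DensityModel (x : EuclideanSpace ℝ (Fin D)) (d : ℕ) (α β τ L fmin fmax R : ℝ)
    (P : Measure (EuclideanSpace ℝ (Fin D))) (f : EuclideanSpace ℝ (Fin D) → ℝ) : Prop where
  isProbability : IsProbabilityMeasure P
  support_mem : ManifoldClass x d α τ L P.support
  measurable : Measurable f
  density : P = (volumeMeasure d P.support).withDensity (fun y => ENNReal.ofReal (f y))
  holder : IsHolderWith P.support β R f
  lower : ∀ y ∈ P.support, fmin ≤ f y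
  upper : ∀ y ∈ P.support, f y ≤ fmax

/-- The pointwise risk `E_{P^{⊗ n}}[|T(X_1, …, X_n) - a|^p]^{1/p}` of the estimator `T` of `a`. -/
def risk (p : ℝ) (n : ℕ) (P : Measure (EuclideanSpace ℝ (Fin D)))
    (T : (Fin n → EuclideanSpace ℝ (Fin D)) → ℝ) (a : ℝ) : ℝ≥0∞ :=
  (∫⁻ X, ENNReal.ofReal (|T X - a| ^ p) ∂(Measure.pi fun _ : Fin n => P)) ^ (1 / p)

/-- The minimax risk at `x` over `Σ^d_{α,β}(τ, L, f_min, f_max, R)`: the infimum over all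
estimators (measurable functions of the sample) of the maximal risk. -/
def minimaxRisk (x : EuclideanSpace ℝ (Fin D)) (d : ℕ) (α β τ L fmin fmax R p : ℝ) (n : ℕ) :
    ℝ≥0∞ :=
  ⨅ (T : (Fin n → EuclideanSpace ℝ (Fin D)) → ℝ) (_ : Measurable T),
    ⨆ (P : Measure (EuclideanSpace ℝ (Fin D))) (f : EuclideanSpace ℝ (Fin D) → ℝ)
      (_ : DensityModel x d α β τ L fmin fmax R P f), risk p n P T (f x)

end Model

end ManifoldDensity

end

/-! Le Cam's two-point method, run on a single round `d`-sphere of radius `τ` through `x`, inside a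
`(d+1)`-dimensional affine subspace. The sphere has reach at least `τ`. The two hypotheses are the
uniform law and the law with density uniform plus `q ψ`, where `ψ` is a bump of width of order `h`
at `x` minus its copy at the antipode. This `ψ` is odd under the antipodal map, so the total mass
stays one without any normalisation, and `ψ x = 1`.

The `β`-Hölder coefficient of `q ψ` is of order `q / h ^ β`, hence `q = a h ^ β`. The chi-square
distance of the two laws is of order `q ^ 2 h ^ d`, and `h = n ^ (-1 / (2β + d))` makes it at most
`1 / (2n)`. The likelihood ratio of the `n`-samples then has second moment at most `2`, no test
separates them, and the minimax risk is at least `q / 4`.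

Constants are free of `D` because, in isometric coordinates on the tangent space, every exponential
map of such a sphere is the same map `expModel` followed by an affine map of bounded norm. The
carrying lemmas are `expMap_embeddedSphere`, `exists_isHolderWith_bumpDiff`,
`lintegral_likelihoodRatio`, `ofReal_abs_sub_div_four_le_minimaxRisk` and
`ofReal_le_rpow_mul_minimaxRisk`. -/

namespace ManifoldDensity

/-! ### Smoothness of even power series, and Hölder bounds by interpolation -/

section Calculus

theorem contDiff_tsum_of_abs_le_inv_factorial (a : ℕ → ℝ)
    (ha : ∀ n, |a n| ≤ 1 / (n.factorial : ℝ)) :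
    ContDiff ℝ ∞ (fun s : ℝ => ∑' n, a n * s ^ n) := by
  have hrad : (FormalMultilinearSeries.ofScalars ℝ a).radius = ⊤ := by
    refine FormalMultilinearSeries.radius_eq_top_of_summable_norm _ fun r => ?_
    refine Summable.of_nonneg_of_le (fun n => by positivity) (fun n => ?_)
      (Real.summable_pow_div_factorial (r : ℝ))
    rw [FormalMultilinearSeries.ofScalars_norm, Real.norm_eq_abs]
    calc |a n| * (r : ℝ) ^ n ≤ 1 / (n.factorial : ℝ) * (r : ℝ) ^ n := by
          gcongr; exact ha n
      _ = _ := by ring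
  have h := (FormalMultilinearSeries.ofScalars ℝ a).hasFPowerSeriesOnBall (by simp [hrad])
  have h2 : AnalyticOnNhd ℝ (FormalMultilinearSeries.ofScalars ℝ a).sum Set.univ := by
    have := h.analyticOnNhd
    rw [hrad] at this
    simpa using this
  have h3 : (FormalMultilinearSeries.ofScalars ℝ a).sum = fun s : ℝ => ∑' n, a n * s ^ n := by
    funext s
    have := FormalMultilinearSeries.ofScalars_sum_eq (E := ℝ) a s
    simpa [FormalMultilinearSeries.ofScalarsSum] using this
  rw [← h3]
  exact contDiffOn_univ.1 (h2.contDiffOn uniqueDiffOn_univ)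

/-- The norm is not smooth at the origin, but its square is. Writing the even functions `cos t` and
`sin t / t` as entire series in `t ^ 2` therefore gives smoothness of the spherical exponential map
at `0`. -/
theorem exists_contDiff_cos_sqrt : ∃ A : ℝ → ℝ, ContDiff ℝ ∞ A ∧ ∀ t, A (t ^ 2) = Real.cos t := by
  refine ⟨fun s => ∑' n : ℕ, ((-1) ^ n / ((2 * n).factorial : ℝ)) * s ^ n,
    contDiff_tsum_of_abs_le_inv_factorial _ fun n => ?_, fun t => ?_⟩
  · rw [abs_div, abs_pow, abs_neg, abs_one, one_pow, Nat.abs_cast]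
    gcongr
    omega
  · rw [← (Real.hasSum_cos t).tsum_eq]
    refine tsum_congr fun n => ?_
    rw [← pow_mul]; ring

theorem exists_contDiff_sin_sqrt_div :
    ∃ B : ℝ → ℝ, ContDiff ℝ ∞ B ∧ ∀ t, t * B (t ^ 2) = Real.sin t := by
  refine ⟨fun s => ∑' n : ℕ, ((-1) ^ n / ((2 * n + 1).factorial : ℝ)) * s ^ n,
    contDiff_tsum_of_abs_le_inv_factorial _ fun n => ?_, fun t => ?_⟩
  · rw [abs_div, abs_pow, abs_neg, abs_one, one_pow, Nat.abs_cast]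
    gcongr
    omega
  · rw [← (Real.hasSum_sin t).tsum_eq, ← tsum_mul_left]
    refine tsum_congr fun n => ?_
    rw [← pow_mul]; ring

variable {F G : Type*} [NormedAddCommGroup F] [NormedSpace ℝ F]
  [NormedAddCommGroup G] [NormedSpace ℝ G]

/-- Interpolation: a bound `a / 2` on the `k`-th and `a / h` on the `(k+1)`-st derivative gives an
`s`-Hölder bound for the `k`-th derivative, at scale `h`. -/
theorem norm_iteratedFDeriv_sub_le_of_bounds {g : F → G} {k : ℕ} (hg : ContDiff ℝ ∞ g)
    {B : Set F} (hB : Convex ℝ B) {a h s : ℝ} (hh : 0 < h) (hs0 : 0 ≤ s) (hs1 : s ≤ 1)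
    (h0 : ∀ v ∈ B, ‖iteratedFDeriv ℝ k g v‖ ≤ a / 2)
    (h1 : ∀ v ∈ B, ‖iteratedFDeriv ℝ (k + 1) g v‖ ≤ a / h) {v w : F} (hv : v ∈ B) (hw : w ∈ B) :
    ‖iteratedFDeriv ℝ k g v - iteratedFDeriv ℝ k g w‖ ≤ a * (‖v - w‖ / h) ^ s := by
  have ha : 0 ≤ a := by linarith [(norm_nonneg _).trans (h0 v hv)]
  set t := ‖v - w‖ / h with ht
  have ht0 : 0 ≤ t := by positivity
  -- Below distance `h` the mean value inequality is the better bound; beyond it, two sup bounds `a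
  -- / 2` add up to `a`.
  rcases le_total t 1 with h' | h'
  · have hlip : ‖iteratedFDeriv ℝ k g v - iteratedFDeriv ℝ k g w‖ ≤ a / h * ‖v - w‖ := by
      refine Convex.norm_image_sub_le_of_norm_fderiv_le (𝕜 := ℝ) (fun x _ => ?_)
        (fun x hx => ?_) hB hw hv
      · exact (hg.differentiable_iteratedFDeriv (m := k)
          (by exact_mod_cast WithTop.coe_lt_coe.2 (ENat.natCast_lt_top k))).differentiableAt
      · rw [norm_fderiv_iteratedFDeriv]; exact h1 x hx
    have hts : t ≤ t ^ s := by
      rcases ht0.eq_or_lt with h'' | h''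
      · rw [← h'']; positivity
      · simpa using Real.rpow_le_rpow_of_exponent_ge h'' h' hs1
    calc _ ≤ a / h * ‖v - w‖ := hlip
      _ = a * t := by rw [ht]; ring
      _ ≤ _ := by gcongr
  · have := Real.one_le_rpow h' hs0
    calc _ ≤ a / 2 + a / 2 := (norm_sub_le _ _).trans (add_le_add (h0 v hv) (h0 w hw))
      _ = a * 1 := by ring
      _ ≤ _ := by gcongr

/-- The Hölder condition sees only differences, so an additive constant drops out even for `k = 0`,
where its own iterated derivative is not zero. -/
theorem iteratedFDeriv_const_add_sub {g : F → G} (hg : ContDiff ℝ ∞ g) (b : G) (k : ℕ) (v w : F) :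
    iteratedFDeriv ℝ k (fun u => b + g u) v - iteratedFDeriv ℝ k (fun u => b + g u) w =
      iteratedFDeriv ℝ k g v - iteratedFDeriv ℝ k g w := by
  have hk : ContDiff ℝ k g := hg.of_le (by exact_mod_cast le_top)
  have key : ∀ v, iteratedFDeriv ℝ k (fun u => b + g u) v =
      iteratedFDeriv ℝ k (fun _ : F => b) v + iteratedFDeriv ℝ k g v := fun v =>
    iteratedFDeriv_add_apply contDiff_const.contDiffAt hk.contDiffAt
  have hc : iteratedFDeriv ℝ k (fun _ : F => b) v = iteratedFDeriv ℝ k (fun _ : F => b) w := by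
    rcases Nat.eq_zero_or_pos k with rfl | hk
    · ext; simp
    · rw [iteratedFDeriv_const_of_ne hk.ne']; rfl
  rw [key, key, hc]; abel

end Calculus

/-! ### The round sphere: geodesics, exponential map, injectivity radius, reach -/

section Sphere

variable {N E : Type*} [NormedAddCommGroup N] [InnerProductSpace ℝ N]
  [NormedAddCommGroup E] [InnerProductSpace ℝ E]

/-- The sphere of centre `c` and radius `r` in the affine subspace `c + J N`. -/
noncomputable def embeddedSphere (J : N →ₗᵢ[ℝ] E) (c : E) (r : ℝ) : Set E :=
  (fun w => c + J w) '' Metric.sphere 0 r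

variable {J : N →ₗᵢ[ℝ] E} {c : E} {r : ℝ}

theorem mem_embeddedSphere {y : E} :
    y ∈ embeddedSphere J c r ↔ y - c ∈ LinearMap.range J.toLinearMap ∧ ‖y - c‖ = r := by
  constructor
  · rintro ⟨w, hw, rfl⟩
    have hw' : ‖w‖ = r := by simpa using hw
    simpa using hw'
  · rintro ⟨⟨w, hw⟩, h⟩
    have hw' : J w = y - c := hw
    refine ⟨w, ?_, by simp [hw']⟩
    rw [mem_sphere_zero_iff_norm, ← J.norm_map, hw', h]

theorem isCompact_embeddedSphere [FiniteDimensional ℝ N] : IsCompact (embeddedSphere J c r) :=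
  (isCompact_sphere 0 r).image (by fun_prop)

theorem isClosed_range_isometry [FiniteDimensional ℝ N] :
    IsClosed (LinearMap.range J.toLinearMap : Set E) :=
  Submodule.closed_of_finiteDimensional _

/-- The great circle through `c + u` with initial velocity `v`. -/
noncomputable def greatCircle (c u v : E) (r : ℝ) (t : ℝ) : E :=
  c + Real.cos (‖v‖ / r * t) • u + (Real.sin (‖v‖ / r * t) / (‖v‖ / r)) • v

theorem greatCircle_zero (u v : E) : greatCircle c u v r 0 = c + u := by simp [greatCircle]

theorem contDiff_greatCircle (u v : E) : ContDiff ℝ ∞ (greatCircle c u v r) := by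
  unfold greatCircle; fun_prop

theorem hasDerivAt_greatCircle (hr : 0 < r) (u v : E) (t : ℝ) :
    HasDerivAt (greatCircle c u v r)
      (-(‖v‖ / r * Real.sin (‖v‖ / r * t)) • u + Real.cos (‖v‖ / r * t) • v) t := by
  set ν := ‖v‖ / r with hν
  have hlin : HasDerivAt (fun t : ℝ => ν * t) ν t := by
    simpa using (hasDerivAt_id t).const_mul ν
  have h1 : HasDerivAt (fun t : ℝ => Real.cos (ν * t) • u) (-(ν * Real.sin (ν * t)) • u) t := by
    convert (hlin.cos.smul_const u) using 2; ring
  have h2 : HasDerivAt (fun t : ℝ => (Real.sin (ν * t) / ν) • v) (Real.cos (ν * t) • v) t := by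
    -- For `v = 0` the quotient takes the default value `0 / 0 = 0`, which is harmless since it
    -- multiplies `v`.
    rcases eq_or_ne v 0 with rfl | hv
    · simpa using hasDerivAt_const t (0 : E)
    · have hν0 : ν ≠ 0 := div_ne_zero (norm_ne_zero_iff.2 hv) hr.ne'
      convert ((hlin.sin.div_const ν).smul_const v) using 2; field_simp
  exact (h1.const_add c).add h2

theorem deriv_greatCircle (hr : 0 < r) (u v : E) :
    deriv (greatCircle c u v r) = fun t =>
      -(‖v‖ / r * Real.sin (‖v‖ / r * t)) • u + Real.cos (‖v‖ / r * t) • v :=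
  funext fun t => (hasDerivAt_greatCircle hr u v t).deriv

theorem deriv_deriv_greatCircle (hr : 0 < r) (u v : E) (t : ℝ) :
    deriv (deriv (greatCircle c u v r)) t = -(‖v‖ / r) ^ 2 • (greatCircle c u v r t - c) := by
  rw [deriv_greatCircle hr]
  set ν := ‖v‖ / r with hν
  have hlin : HasDerivAt (fun t : ℝ => ν * t) ν t := by
    simpa using (hasDerivAt_id t).const_mul ν
  have h1 := (((hlin.sin.const_mul ν).neg).smul_const u).add (hlin.cos.smul_const v)
  rw [show (fun t => -(ν * Real.sin (ν * t)) • u + Real.cos (ν * t) • v) =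
    (fun t => (-(fun y => ν * Real.sin (ν * y))) t • u) + (fun y => Real.cos (ν * y) • v) from rfl,
    h1.deriv]
  have hs : (Real.sin (ν * t) * ν) • v = (ν ^ 2 * (Real.sin (ν * t) / ν)) • v := by
    rcases eq_or_ne ν 0 with h | h
    · simp [h]
    · congr 1; field_simp
  rw [greatCircle, ← hν, add_assoc, add_sub_cancel_left, smul_add, smul_smul, smul_smul,
    neg_mul (Real.sin (ν * t)), neg_smul _ v, hs, neg_mul, neg_mul, neg_smul _ v]
  congr 2; ring

theorem greatCircle_mem (hr : 0 < r) {p v : E} (hp : p ∈ embeddedSphere J c r)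
    (hv : v ∈ LinearMap.range J.toLinearMap) (hvp : inner ℝ v (p - c) = 0) (t : ℝ) :
    greatCircle c (p - c) v r t ∈ embeddedSphere J c r := by
  rw [mem_embeddedSphere] at hp ⊢
  rw [greatCircle, add_assoc, add_sub_cancel_left]
  refine ⟨Submodule.add_mem _ (Submodule.smul_mem _ _ hp.1) (Submodule.smul_mem _ _ hv), ?_⟩
  have h : ‖Real.cos (‖v‖ / r * t) • (p - c) + (Real.sin (‖v‖ / r * t) / (‖v‖ / r)) • v‖ ^ 2
      = r ^ 2 := by
    rw [norm_add_sq_real, inner_smul_left, inner_smul_right, real_inner_comm, hvp, norm_smul,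
      norm_smul, hp.2, mul_pow, mul_pow, Real.norm_eq_abs, Real.norm_eq_abs, sq_abs, sq_abs]
    rcases eq_or_ne v 0 with rfl | hv0
    · simp
    · have : ‖v‖ ≠ 0 := norm_ne_zero_iff.2 hv0
      have := Real.sin_sq_add_cos_sq (‖v‖ / r * t)
      rw [div_pow, div_pow, mul_zero, mul_zero, mul_zero, add_zero]
      generalize Real.sin (‖v‖ / r * t) = S at *
      generalize Real.cos (‖v‖ / r * t) = C at *
      field_simp
      linarith
  rwa [sq_eq_sq₀ (norm_nonneg _) hr.le] at h

/-- Difference quotients lie in a finite-dimensional, hence closed, subspace. Taking `c = 0` applies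
this to the velocity curve too. -/
theorem deriv_mem_of_eventually_mem [FiniteDimensional ℝ N] {γ : ℝ → E} {t : ℝ}
    (h : ∀ᶠ s in 𝓝 t, γ s - c ∈ LinearMap.range J.toLinearMap)
    (hd : DifferentiableAt ℝ γ t) : deriv γ t ∈ LinearMap.range J.toLinearMap := by
  have h1 := (hd.hasDerivAt.tendsto_slope)
  refine isClosed_range_isometry.mem_of_tendsto h1 ?_
  filter_upwards [mem_nhdsWithin_of_mem_nhds h] with s hs
  rw [slope_def_module, ← sub_sub_sub_cancel_right (γ s) (γ t) c]
  exact Submodule.smul_mem _ _ (Submodule.sub_mem _ hs h.self_of_nhds)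

theorem inner_deriv_eq_zero_of_eventually_norm_eq {γ : ℝ → E} {t : ℝ}
    (h : ∀ᶠ s in 𝓝 t, ‖γ s - c‖ = r) (hd : DifferentiableAt ℝ γ t) :
    inner ℝ (deriv γ t) (γ t - c) = 0 := by
  have h1 : HasDerivAt (fun s => inner ℝ (γ s - c) (γ s - c))
      (inner ℝ (γ t - c) (deriv γ t) + inner ℝ (deriv γ t) (γ t - c)) t :=
    (hd.hasDerivAt.sub_const c).inner ℝ (hd.hasDerivAt.sub_const c)
  have h2 : (fun s => inner ℝ (γ s - c) (γ s - c)) =ᶠ[𝓝 t] fun _ => r ^ 2 := by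
    filter_upwards [h] with s hs
    rw [real_inner_self_eq_norm_sq, hs]
  have h3 := h1.unique ((hasDerivAt_const t (r ^ 2)).congr_of_eventuallyEq h2)
  rw [real_inner_comm] at h3
  linarith

/-- Velocities satisfy both linear conditions, which pass to the span; conversely a great circle
realises every such vector as a velocity. -/
theorem mem_tangentSpaceAt_embeddedSphere [FiniteDimensional ℝ N] (hr : 0 < r) {p v : E}
    (hp : p ∈ embeddedSphere J c r) :
    v ∈ tangentSpaceAt (embeddedSphere J c r) p ↔
      v ∈ LinearMap.range J.toLinearMap ∧ inner ℝ v (p - c) = 0 := by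
  constructor
  · intro hv
    refine Submodule.span_induction (p := fun v _ => v ∈ LinearMap.range J.toLinearMap ∧
      inner ℝ v (p - c) = 0) ?_ ?_ ?_ ?_ hv
    · rintro v ⟨γ, hγ, hmem, rfl, rfl⟩
      have hd : DifferentiableAt ℝ γ 0 := hγ.differentiableAt (by simp)
      exact ⟨deriv_mem_of_eventually_mem (hmem.mono fun s hs => (mem_embeddedSphere.1 hs).1) hd,
        inner_deriv_eq_zero_of_eventually_norm_eq
          (hmem.mono fun s hs => (mem_embeddedSphere.1 hs).2) hd⟩
    · exact ⟨Submodule.zero_mem _, inner_zero_left _⟩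
    · rintro v w - - ⟨hv, hv'⟩ ⟨hw, hw'⟩
      exact ⟨Submodule.add_mem _ hv hw, by rw [inner_add_left, hv', hw', add_zero]⟩
    · rintro a v - ⟨hv, hv'⟩
      exact ⟨Submodule.smul_mem _ _ hv, by rw [inner_smul_left, hv', mul_zero]⟩
  · rintro ⟨hv, hvp⟩
    refine Submodule.subset_span ⟨greatCircle c (p - c) v r, (contDiff_greatCircle _ _).contDiffAt,
      .of_forall (greatCircle_mem hr hp hv hvp), by simp [greatCircle_zero], ?_⟩
    simp [deriv_greatCircle hr]

theorem isGeodesic_greatCircle [FiniteDimensional ℝ N] (hr : 0 < r) {p v : E}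
    (hp : p ∈ embeddedSphere J c r)
    (hv : v ∈ tangentSpaceAt (embeddedSphere J c r) p) :
    IsGeodesic (embeddedSphere J c r) (greatCircle c (p - c) v r) := by
  obtain ⟨hv1, hv2⟩ := (mem_tangentSpaceAt_embeddedSphere hr hp).1 hv
  refine ⟨contDiff_greatCircle _ _, greatCircle_mem hr hp hv1 hv2, fun t w hw => ?_⟩
  have := ((mem_tangentSpaceAt_embeddedSphere hr (greatCircle_mem hr hp hv1 hv2 t)).1 hw).2
  rw [deriv_deriv_greatCircle hr, inner_smul_left, real_inner_comm, this, mul_zero]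

theorem IsGeodesic.deriv_mem_tangentSpaceAt {M : Set E} {γ : ℝ → E} (h : IsGeodesic M γ) (t : ℝ) :
    deriv γ t ∈ tangentSpaceAt M (γ t) := by
  refine Submodule.subset_span ⟨fun s => γ (t + s), ?_, .of_forall fun s => h.mem _, by simp, ?_⟩
  · exact (h.smooth.comp (contDiff_const.add contDiff_id)).contDiffAt
  · rw [deriv_comp_const_add, add_zero]

/-- Geodesics have constant speed. -/
theorem IsGeodesic.norm_deriv_sq {M : Set E} {γ : ℝ → E} (h : IsGeodesic M γ) (t : ℝ) :
    ‖deriv γ t‖ ^ 2 = ‖deriv γ 0‖ ^ 2 := by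
  have hd' : ContDiff ℝ ∞ (deriv γ) := (contDiff_infty_iff_deriv.1 h.smooth).2
  have hd : ∀ t, HasDerivAt (deriv γ) (deriv (deriv γ) t) t := fun t =>
    (hd'.differentiable (by simp) t).hasDerivAt
  have h0 : ∀ t, HasDerivAt (fun s => ‖deriv γ s‖ ^ 2) 0 t := fun t => by
    have := (hd t).norm_sq
    rwa [real_inner_comm, h.normal_acceleration t _ (h.deriv_mem_tangentSpaceAt t), mul_zero]
      at this
  exact is_const_of_deriv_eq_zero (fun t => (h0 t).differentiableAt) (fun t => (h0 t).deriv) t 0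

/-- The acceleration stays in the range of `J` and is normal to the sphere, hence radial. Its radial
part comes from differentiating `⟨γ', γ - c⟩ = 0` and constancy of speed. The geodesic equation
thereby becomes a linear oscillator equation, for which uniqueness is elementary. -/
theorem IsGeodesic.deriv_deriv_embeddedSphere [FiniteDimensional ℝ N] (hr : 0 < r) {γ : ℝ → E}
    (h : IsGeodesic (embeddedSphere J c r) γ) (t : ℝ) :
    deriv (deriv γ) t = -(‖deriv γ 0‖ / r) ^ 2 • (γ t - c) := by
  have hd' : ContDiff ℝ ∞ (deriv γ) := (contDiff_infty_iff_deriv.1 h.smooth).2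
  have hd : ∀ t, HasDerivAt (deriv γ) (deriv (deriv γ) t) t := fun t =>
    (hd'.differentiable (by simp) t).hasDerivAt
  have hg : ∀ t, HasDerivAt γ (deriv γ t) t := fun t =>
    (h.smooth.differentiable (by simp) t).hasDerivAt
  have hS := fun s => mem_embeddedSphere.1 (h.mem s)
  have horth : ∀ s, inner ℝ (deriv γ s) (γ s - c) = 0 := fun s =>
    inner_deriv_eq_zero_of_eventually_norm_eq (.of_forall fun s => (hS s).2) (hg s).differentiableAt
  have hrange : ∀ s, deriv γ s ∈ LinearMap.range J.toLinearMap := fun s =>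
    deriv_mem_of_eventually_mem (.of_forall fun s => (hS s).1) (hg s).differentiableAt
  have hrange2 : deriv (deriv γ) t ∈ LinearMap.range J.toLinearMap :=
    deriv_mem_of_eventually_mem (c := 0) (.of_forall fun s => by simpa using hrange s)
      (hd t).differentiableAt
  have hacc : inner ℝ (deriv (deriv γ) t) (γ t - c) = -‖deriv γ 0‖ ^ 2 := by
    have h1 := (hd t).inner ℝ ((hg t).sub_const c)
    have h2 : (fun s => inner ℝ (deriv γ s) (γ s - c)) = fun _ => (0 : ℝ) := funext horth
    rw [h2] at h1
    have h3 := h1.unique (hasDerivAt_const t 0)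
    rw [real_inner_self_eq_norm_sq, h.norm_deriv_sq] at h3
    linarith
  set κ := (‖deriv γ 0‖ / r) ^ 2 with hκ
  -- The defect `z` is tangent, while both of its summands are normal to the sphere; so `z` is
  -- orthogonal to itself.
  set z := deriv (deriv γ) t + κ • (γ t - c) with hz
  have hzT : z ∈ tangentSpaceAt (embeddedSphere J c r) (γ t) := by
    rw [mem_tangentSpaceAt_embeddedSphere hr (h.mem t)]
    refine ⟨Submodule.add_mem _ hrange2 (Submodule.smul_mem _ _ (hS t).1), ?_⟩
    rw [hz, inner_add_left, hacc, inner_smul_left, real_inner_self_eq_norm_sq, (hS t).2, hκ]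
    simp; field_simp; ring
  have hz0 : inner ℝ z z = 0 := by
    conv_lhs => enter [2]; rw [hz]
    rw [inner_add_left, h.normal_acceleration t z hzT, inner_smul_left, real_inner_comm,
      ((mem_tangentSpaceAt_embeddedSphere hr (h.mem t)).1 hzT).2]
    simp
  have := inner_self_eq_zero.1 hz0
  rw [neg_smul]
  exact eq_neg_of_add_eq_zero_left this

/-- The energy `‖δ'‖² + κ ‖δ‖²` is conserved and starts at zero, so `δ' = 0`. Concluding through
`δ'` also covers `κ = 0`, where the energy does not control `δ`. -/
theorem eq_zero_of_deriv_deriv_eq_neg_smul {δ : ℝ → E} {κ : ℝ} (hκ : 0 ≤ κ)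
    (hs : ContDiff ℝ ∞ δ) (h : ∀ t, deriv (deriv δ) t = -κ • δ t) (h0 : δ 0 = 0)
    (h1 : deriv δ 0 = 0) (t : ℝ) : δ t = 0 := by
  have hd' : ContDiff ℝ ∞ (deriv δ) := (contDiff_infty_iff_deriv.1 hs).2
  have hd : ∀ t, HasDerivAt (deriv δ) (deriv (deriv δ) t) t := fun t =>
    (hd'.differentiable (by simp) t).hasDerivAt
  have hg : ∀ t, HasDerivAt δ (deriv δ t) t := fun t =>
    (hs.differentiable (by simp) t).hasDerivAt
  have he : ∀ t, HasDerivAt (fun s => ‖deriv δ s‖ ^ 2 + κ * ‖δ s‖ ^ 2) 0 t := fun t => by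
    have := (hd t).norm_sq.add ((hg t).norm_sq.const_mul κ)
    rw [h, inner_smul_right, real_inner_comm (deriv δ t)] at this
    refine this.congr_deriv ?_
    ring
  have hE : ∀ t, ‖deriv δ t‖ ^ 2 + κ * ‖δ t‖ ^ 2 = 0 := fun t => by
    rw [is_const_of_deriv_eq_zero (fun t => (he t).differentiableAt) (fun t => (he t).deriv) t 0]
    simp [h0, h1]
  have hv : ∀ t, deriv δ t = 0 := fun t => by
    have : 0 ≤ κ * ‖δ t‖ ^ 2 := by positivity
    have h2 : ‖deriv δ t‖ ^ 2 = 0 := by nlinarith [hE t, sq_nonneg ‖deriv δ t‖]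
    simpa using h2
  rw [is_const_of_deriv_eq_zero (fun t => (hg t).differentiableAt) hv t 0, h0]

/-- `expMap` evaluates an arbitrarily chosen geodesic, so existence is not enough: the chosen one
minus the great circle solves the oscillator equation with zero initial data. -/
theorem expMap_embeddedSphere [FiniteDimensional ℝ N] (hr : 0 < r) {p v : E}
    (hp : p ∈ embeddedSphere J c r) (hv : v ∈ tangentSpaceAt (embeddedSphere J c r) p) :
    expMap (embeddedSphere J c r) p v = greatCircle c (p - c) v r 1 := by
  have hex : ∃ γ : ℝ → E, IsGeodesic (embeddedSphere J c r) γ ∧ γ 0 = p ∧ deriv γ 0 = v :=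
    ⟨_, isGeodesic_greatCircle hr hp hv, by simp [greatCircle_zero], by simp [deriv_greatCircle hr]⟩
  rw [expMap, dif_pos hex]
  obtain ⟨hγ, h0, h1⟩ := hex.choose_spec
  set γ := hex.choose
  have hG := contDiff_greatCircle (c := c) (r := r) (p - c) v
  have hsub : deriv (γ - greatCircle c (p - c) v r) =
      deriv γ - deriv (greatCircle c (p - c) v r) := funext fun t =>
    deriv_sub (hγ.smooth.differentiable (by simp) t) (hG.differentiable (by simp) t)
  have := eq_zero_of_deriv_deriv_eq_neg_smul (δ := γ - greatCircle c (p - c) v r)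
    (sq_nonneg (‖v‖ / r)) (hγ.smooth.sub hG) (fun t => ?_) ?_ ?_ 1
  · exact sub_eq_zero.1 this
  · rw [hsub, deriv_sub (((contDiff_infty_iff_deriv.1 hγ.smooth).2).differentiable (by simp) t)
      (((contDiff_infty_iff_deriv.1 hG).2).differentiable (by simp) t),
      hγ.deriv_deriv_embeddedSphere hr, h1, deriv_deriv_greatCircle hr, ← smul_sub]
    congr 1; simp
  · simp [h0, greatCircle_zero]
  · rw [hsub]; simp [h1, deriv_greatCircle hr]

theorem finrank_tangentSpaceAt_embeddedSphere [FiniteDimensional ℝ N] (hr : 0 < r) {d : ℕ}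
    (hd : Module.finrank ℝ N = d + 1) {p : E} (hp : p ∈ embeddedSphere J c r) :
    Module.finrank ℝ (tangentSpaceAt (embeddedSphere J c r) p) = d := by
  have hp' := hp
  obtain ⟨w, hw, rfl⟩ := hp
  have hw0 : w ≠ 0 := by
    rintro rfl
    simp at hw; exact hr.ne hw
  have : tangentSpaceAt (embeddedSphere J c r) (c + J w) =
      (Submodule.span ℝ {w})ᗮ.map J.toLinearMap := by
    ext v
    rw [mem_tangentSpaceAt_embeddedSphere hr hp', Submodule.mem_map]
    constructor
    · rintro ⟨⟨z, rfl⟩, hz⟩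
      refine ⟨z, Submodule.mem_orthogonal_singleton_iff_inner_left.2 ?_, rfl⟩
      simpa using hz
    · rintro ⟨z, hz, rfl⟩
      refine ⟨⟨z, rfl⟩, ?_⟩
      simpa using Submodule.mem_orthogonal_singleton_iff_inner_left.1 hz
  have hfr := LinearMap.finrank_range_of_inj
    (f := J.toLinearMap.domRestrict (Submodule.span ℝ {w})ᗮ)
    (fun a b hab => Subtype.ext (J.injective hab))
  rw [LinearMap.range_domRestrict, ← this] at hfr
  have : Fact (Module.finrank ℝ N = d + 1) := ⟨hd⟩
  exact hfr.trans (Submodule.finrank_orthogonal_span_singleton hw0)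

/-- Opposite tangent vectors of length `π r` both reach the antipode, so injectivity fails on any
larger ball; `1 ≤ d` provides such a vector. This upper bound suffices, because a Hölder bound on a
larger ball restricts to `injBall`. -/
theorem injBall_embeddedSphere_subset [FiniteDimensional ℝ N] (hr : 0 < r) {d : ℕ} (hd1 : 1 ≤ d)
    (hd : Module.finrank ℝ N = d + 1) {p : E} (hp : p ∈ embeddedSphere J c r) :
    injBall (embeddedSphere J c r) p ⊆ Metric.ball 0 (Real.pi * r) := by
  have hfr := finrank_tangentSpaceAt_embeddedSphere hr hd hp
  have : Nontrivial (tangentSpaceAt (embeddedSphere J c r) p) :=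
    Module.nontrivial_of_finrank_pos (R := ℝ) (by omega)
  obtain ⟨v, hv⟩ := exists_norm_eq (tangentSpaceAt (embeddedSphere J c r) p)
    (mul_nonneg Real.pi_pos.le hr.le)
  have hle : injRadius (embeddedSphere J c r) p ≤ ENNReal.ofReal (Real.pi * r) := by
    refine iSup₂_le fun ε hε => ?_
    by_contra hlt
    rw [not_le, ENNReal.ofReal, ENNReal.coe_lt_coe, ← NNReal.coe_lt_coe,
      Real.coe_toNNReal _ (mul_nonneg Real.pi_pos.le hr.le)] at hlt
    obtain ⟨ψ, -, hψ⟩ := hε.continuous_inverse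
    have h1 := hψ (show v ∈ Metric.ball 0 (ε : ℝ) by simpa [hv] using hlt)
    have h2 := hψ (show -v ∈ Metric.ball 0 (ε : ℝ) by simpa [hv] using hlt)
    have hv' : ‖(v : E)‖ / r = Real.pi := by
      rw [← Submodule.coe_norm, hv]; field_simp
    have hexp : expMap (embeddedSphere J c r) p (-v : tangentSpaceAt (embeddedSphere J c r) p) =
        expMap (embeddedSphere J c r) p v := by
      rw [expMap_embeddedSphere hr hp (-v).2, expMap_embeddedSphere hr hp v.2]
      simp only [greatCircle, Submodule.coe_neg, norm_neg, hv']
      simp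
    simp only [hexp] at h2
    have h3 : v = -v := h1.symm.trans h2
    have h4 : v = 0 := by
      have h5 : (2 : ℝ) • v = 0 := by
        rw [two_smul]
        exact add_eq_zero_iff_eq_neg.2 h3
      simpa using h5
    rw [h4, norm_zero] at hv
    exact (mul_pos Real.pi_pos hr).ne hv
  intro w hw
  have : (‖w‖₊ : ℝ≥0∞) < ENNReal.ofReal (Real.pi * r) := lt_of_lt_of_le hw hle
  rw [mem_ball_zero_iff, ← coe_nnnorm]
  rw [ENNReal.ofReal, ENNReal.coe_lt_coe, ← NNReal.coe_lt_coe,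
      Real.coe_toNNReal _ (mul_nonneg Real.pi_pos.le hr.le)] at this
  exact this

/-- With `a` the coordinates of `z - c` along `J`, the squared distance from `z` to `c + J w` is a
constant minus `2⟨a, w⟩`. Equality in Cauchy–Schwarz gives a unique minimiser unless `a = 0`, and
then `z` is at distance at least `r`. Only radii below `r` are tested, as the centre has no unique
nearest point. -/
theorem ofReal_le_reach_embeddedSphere [FiniteDimensional ℝ N] [CompleteSpace E] (hr : 0 < r)
    (hne : (embeddedSphere J c r).Nonempty) :
    ENNReal.ofReal r ≤ reach (embeddedSphere J c r) := by
  refine le_of_forall_lt fun ρ hρ => ?_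
  lift ρ to ℝ≥0 using hρ.ne_top
  obtain ⟨ρ', h1, h2⟩ := exists_between hρ
  lift ρ' to ℝ≥0 using h2.ne_top
  refine h1.trans_le (le_iSup₂_of_le ρ' (fun z hz => ?_) le_rfl)
  have hρr : (ρ' : ℝ) < r := by
    rw [ENNReal.ofReal, ENNReal.coe_lt_coe, ← NNReal.coe_lt_coe, Real.coe_toNNReal _ hr.le] at h2
    exact h2
  obtain ⟨y, hy, hyz⟩ := (isCompact_embeddedSphere (J := J) (c := c)
    (r := r)).exists_infDist_eq_dist hne z
  refine ⟨y, ⟨hy, hyz⟩, ?_⟩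
  set a : N := J.toContinuousLinearMap.adjoint (z - c) with ha
  have hin : ∀ w, inner ℝ (z - c) (J w) = inner ℝ a w := fun w => by
    rw [ha, ContinuousLinearMap.adjoint_inner_left]; rfl
  have hdist : ∀ w, ‖w‖ = r → dist z (c + J w) ^ 2 = ‖z - c‖ ^ 2 + r ^ 2 - 2 * inner ℝ a w := by
    intro w hw
    rw [dist_eq_norm, ← sub_sub, norm_sub_sq_real, hin, J.norm_map, hw]; ring
  have ha0 : a ≠ 0 := by
    intro h0
    obtain ⟨w, hw, rfl⟩ := hy
    have := hdist w (by simpa using hw)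
    rw [h0, inner_zero_left, ← hyz] at this
    nlinarith [sq_nonneg ‖z - c‖, Metric.infDist_nonneg (x := z) (s := embeddedSphere J c r)]
  have ha0' : ‖a‖ ≠ 0 := norm_ne_zero_iff.2 ha0
  set w₀ : N := (r / ‖a‖) • a with hw₀
  have hw₀n : ‖w₀‖ = r := by
    rw [hw₀, norm_smul, Real.norm_of_nonneg (by positivity)]; field_simp
  have key : ∀ y, (y ∈ embeddedSphere J c r ∧
      Metric.infDist z (embeddedSphere J c r) = dist z y) → y = c + J w₀ := by
    rintro y ⟨⟨w, hw, rfl⟩, hy⟩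
    have hw : ‖w‖ = r := by simpa using hw
    have h3 : dist z (c + J w) ^ 2 ≤ dist z (c + J w₀) ^ 2 := by
      rw [← hy]
      have := Metric.infDist_le_dist_of_mem (x := z)
        (show c + J w₀ ∈ embeddedSphere J c r from ⟨w₀, by simpa using hw₀n, rfl⟩)
      have h0 := Metric.infDist_nonneg (x := z) (s := embeddedSphere J c r)
      gcongr
    rw [hdist w hw, hdist w₀ hw₀n] at h3
    have h4 : inner ℝ a w₀ = ‖a‖ * r := by
      rw [hw₀, inner_smul_right, real_inner_self_eq_norm_sq]; field_simp
    have h5 : inner ℝ a w = ‖a‖ * ‖w‖ :=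
      le_antisymm (real_inner_le_norm _ _) (by rw [hw]; linarith)
    have h6 := inner_eq_norm_mul_iff_real.1 h5
    rw [hw] at h6
    have : w = w₀ := by
      rw [hw₀, div_eq_inv_mul, mul_smul, h6, smul_smul, inv_mul_cancel₀ ha0', one_smul]
    rw [this]
  intro y' hy'
  rw [key y' hy', key y ⟨hy, hyz⟩]

end Sphere

/-! ### One model for all exponential maps of the sphere -/

section ExpModel

variable (V : Type*) [NormedAddCommGroup V] [InnerProductSpace ℝ V]

/-- The exponential map of the sphere of radius `r`, in coordinates: the components along the
base point and along the tangent space. -/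
noncomputable def expModel (r : ℝ) (w : V) : ℝ × V :=
  (Real.cos (‖w‖ / r), (Real.sin (‖w‖ / r) / (‖w‖ / r)) • w)

theorem contDiff_expModel {r : ℝ} (hr : 0 < r) : ContDiff ℝ ∞ (expModel V r) := by
  obtain ⟨A, hA, hA'⟩ := exists_contDiff_cos_sqrt
  obtain ⟨B, hB, hB'⟩ := exists_contDiff_sin_sqrt_div
  have hn : ContDiff ℝ ∞ (fun w : V => ‖w‖ ^ 2 / r ^ 2) := (contDiff_norm_sq ℝ).div_const _
  have h : expModel V r = fun w => (A (‖w‖ ^ 2 / r ^ 2), B (‖w‖ ^ 2 / r ^ 2) • w) := by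
    funext w
    rw [expModel, ← div_pow, hA']
    congr 1
    rcases eq_or_ne w 0 with rfl | hw
    · simp
    · have : ‖w‖ / r ≠ 0 := div_ne_zero (norm_ne_zero_iff.2 hw) hr.ne'
      rw [← hB']; congr 1; field_simp
  rw [h]
  exact (hA.comp hn).prodMk ((hB.comp hn).smul contDiff_id)

/-- Compactness of the closed ball. The normalisation `1 ≤ K` allows powers of `K` to be raised
freely in chain-rule bounds. -/
theorem exists_bound_iteratedFDeriv_expModel [FiniteDimensional ℝ V] {r : ℝ} (hr : 0 < r) (k : ℕ) :
    ∃ K : ℝ, 1 ≤ K ∧ ∀ i ≤ k, ∀ w ∈ Metric.ball (0 : V) (Real.pi * r),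
      ‖iteratedFDeriv ℝ i (expModel V r) w‖ ≤ K := by
  have h : ∀ i : ℕ, ∃ K : ℝ, ∀ w ∈ Metric.closedBall (0 : V) (Real.pi * r),
      ‖iteratedFDeriv ℝ i (expModel V r) w‖ ≤ K := fun i =>
    (isCompact_closedBall _ _).exists_bound_of_continuousOn
      ((contDiff_expModel V hr).continuous_iteratedFDeriv (by exact_mod_cast le_top)).continuousOn
  choose K hK using h
  refine ⟨1 + ∑ i ∈ Finset.range (k + 1), |K i|, ?_, fun i hi w hw => ?_⟩
  · have : 0 ≤ ∑ i ∈ Finset.range (k + 1), |K i| := Finset.sum_nonneg fun _ _ => abs_nonneg _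
    linarith
  · have h1 := hK i w (Metric.ball_subset_closedBall hw)
    have h2 : |K i| ≤ ∑ i ∈ Finset.range (k + 1), |K i| :=
      Finset.single_le_sum (f := fun i => |K i|) (fun _ _ => abs_nonneg _)
        (Finset.mem_range.2 (by omega))
    linarith [le_abs_self (K i)]

end ExpModel

theorem sub_natCeil_sub_one_nonneg {γ : ℝ} (hγ : 0 ≤ γ) : 0 ≤ γ - (⌈γ - 1⌉₊ : ℝ) := by
  rcases le_total γ 1 with h | h
  · rw [Nat.ceil_eq_zero.2 (by linarith)]; simpa using hγ
  · linarith [Nat.ceil_lt_add_one (show 0 ≤ γ - 1 by linarith)]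

theorem sub_natCeil_sub_one_le_one (γ : ℝ) : γ - (⌈γ - 1⌉₊ : ℝ) ≤ 1 := by
  linarith [Nat.le_ceil (γ - 1)]

/-! ### Hölder bounds on the sphere, uniform in the ambient dimension -/

section Sphere

variable {N E G : Type*} [NormedAddCommGroup N] [InnerProductSpace ℝ N] [FiniteDimensional ℝ N]
  [NormedAddCommGroup E] [InnerProductSpace ℝ E] [NormedAddCommGroup G] [NormedSpace ℝ G]
  {J : N →ₗᵢ[ℝ] E} {c : E} {r : ℝ} {d : ℕ}

/-- The constant `b` is split off because for `k = 0` the bound `a / 2` constrains the values of `g`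
themselves, and these must not include the level of the density or the position of the centre. -/
theorem isHolderWith_embeddedSphere_of_bounds (hr : 0 < r) (hd1 : 1 ≤ d)
    (hd : Module.finrank ℝ N = d + 1) {γ a h : ℝ} (hγ : 0 ≤ γ) (hh : 0 < h) {f : E → G}
    (H : ∀ p ∈ embeddedSphere J c r, ∃ (b : G)
      (g : tangentSpaceAt (embeddedSphere J c r) p → G), ContDiff ℝ ∞ g ∧
      (∀ v : tangentSpaceAt (embeddedSphere J c r) p,
        f (expMap (embeddedSphere J c r) p v) = b + g v) ∧
      ∀ v ∈ Metric.ball 0 (Real.pi * r),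
        ‖iteratedFDeriv ℝ ⌈γ - 1⌉₊ g v‖ ≤ a / 2 ∧
        ‖iteratedFDeriv ℝ (⌈γ - 1⌉₊ + 1) g v‖ ≤ a / h) :
    IsHolderWith (embeddedSphere J c r) γ (a / h ^ (γ - (⌈γ - 1⌉₊ : ℝ))) f := by
  constructor
  · intro p hp
    obtain ⟨b, g, hg, hfg, -⟩ := H p hp
    simp only [hfg]
    exact ((contDiff_const.add hg).of_le (by exact_mod_cast le_top)).contDiffOn
  · intro p hp v hv w hw
    obtain ⟨b, g, hg, hfg, hb⟩ := H p hp
    have hsub := injBall_embeddedSphere_subset hr hd1 hd hp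
    simp only [hfg]
    rw [iteratedFDeriv_const_add_sub hg]
    refine (norm_iteratedFDeriv_sub_le_of_bounds hg (convex_ball 0 _) hh
      (sub_natCeil_sub_one_nonneg hγ) (sub_natCeil_sub_one_le_one γ) (fun v hv => (hb v hv).1)
      (fun v hv => (hb v hv).2) (hsub hv) (hsub hw)).trans_eq ?_
    rw [Real.div_rpow (norm_nonneg _) hh.le]; ring

theorem IsHolderWith.mono {M : Set E} {γ K K' : ℝ} {f : E → G} (h : IsHolderWith M γ K f)
    (hK : K ≤ K') : IsHolderWith M γ K' f :=
  ⟨h.contDiffOn, fun p hp v hv w hw => (h.holder p hp v hv w hw).trans (by gcongr)⟩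

/-- In isometric coordinates on the tangent space, the exponential map of the sphere is `expModel`
followed by an affine map whose linear part has norm at most `r + 1`. -/
theorem exists_expMap_eq_expModel [FiniteDimensional ℝ E] (hr : 0 < r)
    (hd : Module.finrank ℝ N = d + 1) {p : E} (hp : p ∈ embeddedSphere J c r) :
    ∃ (I : tangentSpaceAt (embeddedSphere J c r) p ≃ₗᵢ[ℝ] EuclideanSpace ℝ (Fin d))
      (Λ : ℝ × EuclideanSpace ℝ (Fin d) →L[ℝ] E), ‖Λ‖ ≤ r + 1 ∧
      ∀ v : tangentSpaceAt (embeddedSphere J c r) p,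
        expMap (embeddedSphere J c r) p v =
          c + Λ (expModel (EuclideanSpace ℝ (Fin d)) r (I v)) := by
  let I : tangentSpaceAt (embeddedSphere J c r) p ≃ₗᵢ[ℝ] EuclideanSpace ℝ (Fin d) :=
    ((stdOrthonormalBasis ℝ (tangentSpaceAt (embeddedSphere J c r) p)).reindex
      (finCongr (finrank_tangentSpaceAt_embeddedSphere hr hd hp))).repr
  let Λ : ℝ × EuclideanSpace ℝ (Fin d) →L[ℝ] E :=
    (ContinuousLinearMap.toSpanSingleton ℝ (p - c)).coprod
      ((tangentSpaceAt (embeddedSphere J c r) p).subtypeL.comp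
        I.symm.toContinuousLinearEquiv.toContinuousLinearMap)
  have hΛ : ∀ z, Λ z = z.1 • (p - c) + (I.symm z.2 : E) := fun z => rfl
  refine ⟨I, Λ, ?_, fun v => ?_⟩
  · refine ContinuousLinearMap.opNorm_le_bound _ (by positivity) fun z => ?_
    rw [hΛ]
    calc _ ≤ ‖z.1‖ * r + ‖z.2‖ := by
          refine (norm_add_le _ _).trans (add_le_add ?_ ?_)
          · rw [norm_smul, (mem_embeddedSphere.1 hp).2]
          · rw [← Submodule.coe_norm, I.symm.norm_map]
      _ ≤ ‖z‖ * r + ‖z‖ := by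
          gcongr
          · exact norm_fst_le z
          · exact norm_snd_le z
      _ = _ := by ring
  · rw [expMap_embeddedSphere hr hp v.2, hΛ, greatCircle]
    simp only [expModel, I.norm_map, map_smul, I.symm_apply_apply, mul_one, Submodule.coe_norm,
      Submodule.coe_smul, add_assoc]

/-- `L₀` can precede `D`, `J`, `c` since only `expModel` and the bound `r + 1` on the linear part
enter. No small scale is involved, hence `h = 1`. -/
theorem exists_isHolderWith_id (d : ℕ) (hd1 : 1 ≤ d) {r γ : ℝ} (hr : 0 < r) (hγ : 0 ≤ γ) :
    ∃ L₀ : ℝ, ∀ (D : ℕ) (J : EuclideanSpace ℝ (Fin (d + 1)) →ₗᵢ[ℝ] EuclideanSpace ℝ (Fin D))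
      (c : EuclideanSpace ℝ (Fin D)),
      IsHolderWith (embeddedSphere J c r) γ L₀ (fun y => y) := by
  obtain ⟨K, hK1, hK⟩ := exists_bound_iteratedFDeriv_expModel (EuclideanSpace ℝ (Fin d)) hr
    (⌈γ - 1⌉₊ + 1)
  refine ⟨_, fun D J c => isHolderWith_embeddedSphere_of_bounds (a := 2 * ((r + 1) * K)) (h := 1) hr
    hd1 (by simp) hγ one_pos fun p hp => ?_⟩
  obtain ⟨I, Λ, hΛ, hexp⟩ := exists_expMap_eq_expModel (d := d) hr (by simp) hp
  have hE := contDiff_expModel (EuclideanSpace ℝ (Fin d)) hr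
  refine ⟨c, fun v => Λ (expModel _ r (I v)),
    Λ.contDiff.comp (hE.comp I.toContinuousLinearEquiv.contDiff), hexp, fun v hv => ?_⟩
  have key : ∀ i ≤ ⌈γ - 1⌉₊ + 1,
      ‖iteratedFDeriv ℝ i (fun v => Λ (expModel _ r (I v))) v‖ ≤ (r + 1) * K := by
    intro i hi
    have h1 := I.norm_iteratedFDeriv_comp_right (Λ ∘ expModel _ r) v i
    change ‖iteratedFDeriv ℝ i ((Λ ∘ expModel _ r) ∘ I) v‖ ≤ _
    rw [h1]
    refine (Λ.norm_iteratedFDeriv_comp_left (hE.contDiffAt (x := I v))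
      (by exact_mod_cast le_top)).trans ?_
    have hv' : I v ∈ Metric.ball (0 : EuclideanSpace ℝ (Fin d)) (Real.pi * r) := by
      rw [mem_ball_zero_iff, I.norm_map]; simpa using hv
    exact mul_le_mul hΛ (hK i hi _ hv') (norm_nonneg _) (by positivity)
  exact ⟨(key _ (by omega)).trans (by linarith), (key _ le_rfl).trans (by
    have : 0 ≤ (r + 1) * K := by positivity
    linarith)⟩

theorem exists_bound_iteratedFDeriv_of_hasCompactSupport {W : Type*} [NormedAddCommGroup W]
    [NormedSpace ℝ W] {g : W → ℝ} (hg : ContDiff ℝ ∞ g)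
    (hc : HasCompactSupport g) (k : ℕ) :
    ∃ K : ℝ, 0 < K ∧ ∀ i ≤ k, ∀ w, ‖iteratedFDeriv ℝ i g w‖ ≤ K := by
  have h : ∀ i : ℕ, ∃ K : ℝ, ∀ w, ‖iteratedFDeriv ℝ i g w‖ ≤ K := fun i =>
    (hg.continuous_iteratedFDeriv (m := i)
      (by exact_mod_cast le_top)).bounded_above_of_compact_support (hc.iteratedFDeriv i)
  choose K hK using h
  refine ⟨1 + ∑ i ∈ Finset.range (k + 1), |K i|, by positivity, fun i hi w => ?_⟩
  have h1 := hK i w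
  have h2 : |K i| ≤ ∑ i ∈ Finset.range (k + 1), |K i| :=
    Finset.single_le_sum (f := fun i => |K i|) (fun _ _ => abs_nonneg _)
      (Finset.mem_range.2 (by omega))
  linarith [le_abs_self (K i)]

/-- The difference of two copies of the bump `Φ`, at scale `h`, centred at `x` and `x'`, read
through the adjoint of the isometry `J`. -/
noncomputable def bumpDiff [FiniteDimensional ℝ E] (J : N →ₗᵢ[ℝ] E) (Φ : N → ℝ) (x x' : E) (h : ℝ)
    (y : E) : ℝ :=
  Φ (h⁻¹ • J.toContinuousLinearMap.adjoint (y - x)) -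
    Φ (h⁻¹ • J.toContinuousLinearMap.adjoint (y - x'))

/-- Each derivative costs one factor `h⁻¹`. The Faà di Bruno estimate needs the `i`-th derivative of
the inner map below the `i`-th power of one number; as `ρ * K / h ≥ 1`, a bound by its first power
is enough. -/
theorem norm_iteratedFDeriv_comp_scaled_expModel_le {V W : Type*} [NormedAddCommGroup V]
    [InnerProductSpace ℝ V] [NormedAddCommGroup W] [NormedSpace ℝ W] {r K C h ρ : ℝ}
    (hr : 0 < r) (hK1 : 1 ≤ K) (hh : 0 < h) (hh1 : h ≤ 1)
    (hρ : 1 ≤ ρ) {Φ : W → ℝ} (hΦ : ContDiff ℝ ∞ Φ) (b : W) (Λ : ℝ × V →L[ℝ] W) (hΛ : ‖Λ‖ ≤ ρ)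
    {n : ℕ} {w : V} (hC : ∀ i ≤ n, ∀ z, ‖iteratedFDeriv ℝ i Φ z‖ ≤ C)
    (hK : ∀ i ≤ n, ‖iteratedFDeriv ℝ i (expModel V r) w‖ ≤ K) :
    ‖iteratedFDeriv ℝ n (fun w => Φ (b + h⁻¹ • Λ (expModel V r w))) w‖ ≤
      n.factorial * C * (ρ * K) ^ n / h ^ n := by
  have hE := contDiff_expModel V hr
  have hf : ContDiff ℝ ∞ ((h⁻¹ • Λ) ∘ expModel V r) := (h⁻¹ • Λ).contDiff.comp hE
  have hb : ∀ i, 1 ≤ i → i ≤ n →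
      ‖iteratedFDeriv ℝ i ((h⁻¹ • Λ) ∘ expModel V r) w‖ ≤ (ρ * K / h) ^ i := by
    intro i hi hin
    have h1 : 1 ≤ ρ * K / h := by
      rw [one_le_div hh]; nlinarith
    calc _ ≤ ‖h⁻¹ • Λ‖ * ‖iteratedFDeriv ℝ i (expModel V r) w‖ :=
          (h⁻¹ • Λ).norm_iteratedFDeriv_comp_left hE.contDiffAt (by exact_mod_cast le_top)
      _ ≤ (h⁻¹ * ρ) * K := by
          refine mul_le_mul ?_ (hK i hin) (norm_nonneg _) (by positivity)
          refine ContinuousLinearMap.opNorm_le_bound _ (by positivity) fun z => ?_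
          rw [smul_apply, norm_smul, Real.norm_of_nonneg (by positivity),
            mul_assoc]
          gcongr
          exact Λ.le_of_opNorm_le hΛ z
      _ = ρ * K / h := by ring
      _ ≤ _ := le_self_pow₀ h1 (by omega)
  have hΦb : ContDiff ℝ ∞ (fun z => Φ (b + z)) := hΦ.comp (contDiff_const.add contDiff_id)
  have := norm_iteratedFDeriv_comp_le hΦb hf (n := n) (by exact_mod_cast le_top) w (C := C)
    (D := ρ * K / h) (fun i hi => by rw [iteratedFDeriv_comp_add_left]; exact hC i hi _) hb
  refine this.trans_eq ?_
  rw [div_pow]; ring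

/-- The derivatives of orders `k` and `k + 1` are of order `q / h ^ k` and `q / h ^ (k + 1)`;
interpolating at scale `h` yields `q / h ^ β`. The adjoint of `J` has norm at most one, so `D` does
not enter `M`. -/
theorem exists_isHolderWith_bumpDiff (d : ℕ) (hd1 : 1 ≤ d) {r β : ℝ} (hr : 0 < r) (hβ : 0 ≤ β)
    {Φ : EuclideanSpace ℝ (Fin (d + 1)) → ℝ} (hΦ : ContDiff ℝ ∞ Φ) (hΦc : HasCompactSupport Φ) :
    ∃ M : ℝ, 0 < M ∧ ∀ (D : ℕ)
      (J : EuclideanSpace ℝ (Fin (d + 1)) →ₗᵢ[ℝ] EuclideanSpace ℝ (Fin D))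
      (c x x' : EuclideanSpace ℝ (Fin D)) (h q b : ℝ), 0 < h → h ≤ 1 → 0 ≤ q →
      IsHolderWith (embeddedSphere J c r) β (M * q / h ^ β)
        (fun y => b + q * bumpDiff J Φ x x' h y) := by
  set k := ⌈β - 1⌉₊ with hk
  obtain ⟨K, hK1, hK⟩ := exists_bound_iteratedFDeriv_expModel (EuclideanSpace ℝ (Fin d)) hr (k + 1)
  obtain ⟨C, hC0, hC⟩ := exists_bound_iteratedFDeriv_of_hasCompactSupport hΦ hΦc (k + 1)
  have hρ : 1 ≤ (r + 1) := by linarith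
  set M₀ : ℝ := (k + 1).factorial * C * ((r + 1) * K) ^ (k + 1) with hM₀
  have hM₀p : 0 < M₀ := by positivity
  -- A factor `2` for the two bumps, and another because the interpolation lemma takes `a / 2`.
  refine ⟨4 * M₀, by positivity, fun D J c x x' h q b hh hh1 hq => ?_⟩
  have hconst : 4 * M₀ * q / h ^ β = (4 * M₀ * q / h ^ k) / h ^ (β - (k : ℝ)) := by
    rw [Real.rpow_sub hh, Real.rpow_natCast]; field_simp
  rw [hconst]
  refine isHolderWith_embeddedSphere_of_bounds hr hd1 (by simp) hβ hh fun p hp => ?_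
  obtain ⟨I, Λ, hΛ, hexp⟩ := exists_expMap_eq_expModel (d := d) hr (by simp) hp
  set V := EuclideanSpace ℝ (Fin d)
  set JT := J.toContinuousLinearMap.adjoint with hJT
  have hJn : ‖JT‖ ≤ 1 := by
    rw [hJT, LinearIsometryEquiv.norm_map]
    exact J.norm_toContinuousLinearMap_le
  have hΛ' : ‖JT.comp Λ‖ ≤ r + 1 := (JT.opNorm_comp_le Λ).trans
    ((mul_le_mul hJn hΛ (norm_nonneg _) zero_le_one).trans_eq (one_mul _))
  let g : EuclideanSpace ℝ (Fin D) → V → ℝ := fun z w =>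
    Φ (h⁻¹ • JT (c - z) + h⁻¹ • (JT.comp Λ) (expModel V r w))
  have hE := contDiff_expModel V hr
  have hg : ∀ z, ContDiff ℝ ∞ (g z) := fun z =>
    hΦ.comp (contDiff_const.add (((JT.comp Λ).contDiff.comp hE).const_smul h⁻¹))
  have hgb : ∀ z, ∀ w ∈ Metric.ball (0 : V) (Real.pi * r), ∀ n ≤ k + 1,
      ‖iteratedFDeriv ℝ n (g z) w‖ ≤ M₀ / h ^ n := by
    intro z w hw n hn
    refine (norm_iteratedFDeriv_comp_scaled_expModel_le hr hK1 hh hh1 hρ hΦ _ _ hΛ'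
      (fun i hi => hC i (hi.trans hn)) (fun i hi => hK i (hi.trans hn) w hw)).trans ?_
    rw [hM₀]
    have : 1 ≤ (r + 1) * K := by nlinarith
    gcongr
  let G : V → ℝ := q • (g x - g x')
  have hG : ContDiff ℝ ∞ G := ((hg x).sub (hg x')).const_smul q
  have hGb : ∀ w ∈ Metric.ball (0 : V) (Real.pi * r), ∀ n ≤ k + 1,
      ‖iteratedFDeriv ℝ n G w‖ ≤ 2 * M₀ * q / h ^ n := by
    intro w hw n hn
    have hgn : ∀ z, ContDiff ℝ n (g z) := fun z => (hg z).of_le (by exact_mod_cast le_top)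
    have h1 : iteratedFDeriv ℝ n G w =
        q • (iteratedFDeriv ℝ n (g x) w - iteratedFDeriv ℝ n (g x') w) := by
      rw [← iteratedFDeriv_sub_apply (hgn x).contDiffAt (hgn x').contDiffAt]
      exact iteratedFDeriv_const_smul_apply ((hgn x).sub (hgn x')).contDiffAt
    rw [h1, norm_smul, Real.norm_of_nonneg hq]
    calc _ ≤ q * (M₀ / h ^ n + M₀ / h ^ n) := by
          gcongr
          exact (norm_sub_le _ _).trans (add_le_add (hgb x w hw n hn) (hgb x' w hw n hn))
      _ = _ := by ring
  refine ⟨b, G ∘ I, hG.comp I.toContinuousLinearEquiv.contDiff, fun v => ?_, fun v hv => ?_⟩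
  · have hz : ∀ z, h⁻¹ • JT (expMap (embeddedSphere J c r) p v - z) =
        h⁻¹ • JT (c - z) + h⁻¹ • (JT.comp Λ) (expModel V r (I v)) := fun z => by
      rw [hexp, ← smul_add, ContinuousLinearMap.comp_apply, ← map_add]
      congr 2; abel
    simp only [bumpDiff, ← hJT, hz]
    rfl
  · have hv' : I v ∈ Metric.ball (0 : V) (Real.pi * r) := by
      rw [mem_ball_zero_iff, I.norm_map]; simpa using hv
    rw [I.norm_iteratedFDeriv_comp_right, I.norm_iteratedFDeriv_comp_right]
    refine ⟨(hGb _ hv' k (by omega)).trans_eq (by ring), (hGb _ hv' (k + 1) le_rfl).trans ?_⟩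
    rw [pow_succ, ← div_div]
    gcongr
    norm_num

end Sphere

/-! ### Hemispheres as graphs over the tangent space -/

section Chart

variable {N E : Type*} [NormedAddCommGroup N] [InnerProductSpace ℝ N]
  [NormedAddCommGroup E] [InnerProductSpace ℝ E]
  {J : N →ₗᵢ[ℝ] E} {c : E} {r : ℝ} {d : ℕ}

theorem abs_sqrt_one_sub_sub_le {a b : ℝ} (ha : a ≤ 3 / 4) (hb : b ≤ 3 / 4) :
    |√(1 - a) - √(1 - b)| ≤ |a - b| := by
  have h1 : 1 / 2 ≤ √(1 - a) := Real.le_sqrt_of_sq_le (by norm_num; linarith)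
  have h2 : 1 / 2 ≤ √(1 - b) := Real.le_sqrt_of_sq_le (by norm_num; linarith)
  have h3 : (√(1 - a) - √(1 - b)) * (√(1 - a) + √(1 - b)) = b - a := by
    ring_nf; rw [Real.sq_sqrt (by linarith), Real.sq_sqrt (by linarith)]; ring
  calc |√(1 - a) - √(1 - b)| ≤ |√(1 - a) - √(1 - b)| * (√(1 - a) + √(1 - b)) :=
        le_mul_of_one_le_right (abs_nonneg _) (by linarith)
    _ = |b - a| := by
        rw [← h3, abs_mul, abs_of_nonneg (show 0 ≤ √(1 - a) + √(1 - b) by linarith)]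
    _ = |a - b| := abs_sub_comm _ _

/-- A hemisphere of the sphere, as a graph over the tangent space at its pole `p`. -/
structure IsGraphChart (J : N →ₗᵢ[ℝ] E) (c : E) (r : ℝ) (d : ℕ) (p : E)
    (φ : EuclideanSpace ℝ (Fin d) → E) (ψ : E → EuclideanSpace ℝ (Fin d)) : Prop where
  contDiffOn : ContDiffOn ℝ ∞ φ (Metric.ball 0 r)
  lipschitzOn : LipschitzOnWith 3 φ {w | ‖w‖ ^ 2 ≤ 3 / 4 * r ^ 2}
  differentiable : Differentiable ℝ ψ
  lipschitz : LipschitzWith 1 ψ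
  left_inv : ∀ w, ψ (φ w) = w
  map_zero : φ 0 = p
  mapsTo : ∀ w ∈ Metric.ball 0 r, φ w ∈ embeddedSphere J c r ∧ 0 < inner ℝ (φ w - c) (p - c)
  norm_sq : ∀ y ∈ embeddedSphere J c r, r ^ 2 * ‖ψ y‖ ^ 2 = r ^ 4 - inner ℝ (y - c) (p - c) ^ 2
  right_inv : ∀ y ∈ embeddedSphere J c r, 0 < inner ℝ (y - c) (p - c) → φ (ψ y) = y

/-- The inverse chart is the orthogonal projection onto the tangent space, hence `1`-Lipschitz; the
chart restores the component along `p - c` by Pythagoras. -/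
theorem exists_isGraphChart [FiniteDimensional ℝ N] [FiniteDimensional ℝ E]
    (hr : 0 < r) (hd : Module.finrank ℝ N = d + 1) {p : E}
    (hp : p ∈ embeddedSphere J c r) : ∃ φ ψ, IsGraphChart J c r d p φ ψ := by
  let T := tangentSpaceAt (embeddedSphere J c r) p
  have hT : ∀ v, v ∈ T ↔ v ∈ LinearMap.range J.toLinearMap ∧ inner ℝ v (p - c) = 0 := fun v =>
    mem_tangentSpaceAt_embeddedSphere hr hp
  obtain ⟨hpJ, hpr⟩ := mem_embeddedSphere.1 hp
  let I : T ≃ₗᵢ[ℝ] EuclideanSpace ℝ (Fin d) :=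
    ((stdOrthonormalBasis ℝ T).reindex
      (finCongr (finrank_tangentSpaceAt_embeddedSphere hr hd hp))).repr
  let φ : EuclideanSpace ℝ (Fin d) → E := fun w =>
    c + √(1 - ‖w‖ ^ 2 / r ^ 2) • (p - c) + (I.symm w : E)
  let ψ : E → EuclideanSpace ℝ (Fin d) := fun y => I (T.orthogonalProjectionOnto (y - c))
  have hP0 : T.orthogonalProjectionOnto (p - c) = 0 :=
    Submodule.orthogonalProjectionOnto_eq_zero_iff.2
      ((Submodule.mem_orthogonal _ _).2 fun v hv => ((hT v).1 hv).2)
  have hIp : ∀ w, inner ℝ (I.symm w : E) (p - c) = 0 := fun w => ((hT _).1 (I.symm w).2).2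
  have hdecomp : ∀ y ∈ embeddedSphere J c r,
      y - c = (inner ℝ (y - c) (p - c) / r ^ 2) • (p - c) + (I.symm (ψ y) : E) := by
    intro y hy
    have hmem : y - c - (inner ℝ (y - c) (p - c) / r ^ 2) • (p - c) ∈ T := by
      rw [hT]
      refine ⟨Submodule.sub_mem _ (mem_embeddedSphere.1 hy).1 (Submodule.smul_mem _ _ hpJ), ?_⟩
      rw [inner_sub_left, inner_smul_left, real_inner_self_eq_norm_sq, hpr]
      simp; field_simp; ring
    have h1 : T.orthogonalProjectionOnto (y - c) =
        ⟨y - c - (inner ℝ (y - c) (p - c) / r ^ 2) • (p - c), hmem⟩ := by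
      have := Submodule.orthogonalProjectionOnto_mem_subspace_eq_self (K := T) ⟨_, hmem⟩
      rw [← this]
      simp [map_sub, map_smul, hP0]
    simp only [ψ]
    rw [h1, I.symm_apply_apply]
    exact (add_sub_cancel _ _).symm
  have hnorm : ∀ y ∈ embeddedSphere J c r,
      r ^ 2 * ‖ψ y‖ ^ 2 = r ^ 4 - inner ℝ (y - c) (p - c) ^ 2 := by
    intro y hy
    have h1 : ‖y - c‖ ^ 2 = r ^ 2 := by rw [(mem_embeddedSphere.1 hy).2]
    rw [hdecomp y hy, norm_add_sq_real, inner_smul_left, real_inner_comm _ (p - c), hIp, norm_smul,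
      hpr, ← Submodule.coe_norm, I.symm.norm_map, mul_pow, Real.norm_eq_abs, sq_abs] at h1
    field_simp at h1
    linarith
  have hinner : ∀ w, inner ℝ (φ w - c) (p - c) = √(1 - ‖w‖ ^ 2 / r ^ 2) * r ^ 2 := fun w => by
    simp only [φ]
    rw [add_assoc, add_sub_cancel_left, inner_add_left, hIp, inner_smul_left,
      real_inner_self_eq_norm_sq, hpr]
    simp
  refine ⟨φ, ψ, ?_, ?_, ?_, ?_, fun w => ?_, ?_, fun w hw => ?_, hnorm, fun y hy hpos => ?_⟩
  · have hs : ContDiffOn ℝ ∞ (fun w : EuclideanSpace ℝ (Fin d) => √(1 - ‖w‖ ^ 2 / r ^ 2))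
        (Metric.ball 0 r) := by
      refine ContDiffOn.sqrt
        (contDiff_const.sub ((contDiff_norm_sq ℝ).div_const _)).contDiffOn fun w hw => ?_
      have hw : ‖w‖ < r := by simpa using hw
      have : ‖w‖ ^ 2 / r ^ 2 < 1 := by
        rw [div_lt_one (by positivity)]; gcongr
      linarith
    exact (contDiffOn_const.add (hs.smul contDiffOn_const)).add
      ((T.subtypeL.comp I.symm.toContinuousLinearEquiv.toContinuousLinearMap).contDiff.contDiffOn)
  -- The constant `3` is `2` from the component along `p - c` plus `1` from the tangential one.
  · refine LipschitzOnWith.of_dist_le_mul fun w hw z hz => ?_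
    simp only [Set.mem_ofPred_eq] at hw hz
    have ha : ∀ w : EuclideanSpace ℝ (Fin d), ‖w‖ ^ 2 ≤ 3 / 4 * r ^ 2 →
        ‖w‖ ^ 2 / r ^ 2 ≤ 3 / 4 ∧ ‖w‖ ≤ r := fun w hw => by
      refine ⟨(div_le_iff₀ (by positivity)).2 hw, ?_⟩
      refine le_of_sq_le_sq ?_ hr.le
      nlinarith
    have h1 := abs_sqrt_one_sub_sub_le (ha w hw).1 (ha z hz).1
    have h2 : |‖w‖ ^ 2 / r ^ 2 - ‖z‖ ^ 2 / r ^ 2| * r ≤ 2 * ‖w - z‖ := by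
      rw [← sub_div, abs_div, abs_of_pos (show 0 < r ^ 2 by positivity), sq_sub_sq, abs_mul,
        abs_of_nonneg (show 0 ≤ ‖w‖ + ‖z‖ by positivity)]
      have h3 := abs_norm_sub_norm_le w z
      have h4 : ‖w‖ + ‖z‖ ≤ 2 * r := by linarith [(ha w hw).2, (ha z hz).2]
      calc _ ≤ (2 * r) * ‖w - z‖ / r ^ 2 * r := by gcongr
        _ = _ := by field_simp
    have h5 : φ w - φ z = (√(1 - ‖w‖ ^ 2 / r ^ 2) - √(1 - ‖z‖ ^ 2 / r ^ 2)) • (p - c) +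
        ((I.symm (w - z) : T) : E) := by
      simp only [φ, map_sub, Submodule.coe_sub, sub_smul]; abel
    rw [dist_eq_norm, dist_eq_norm, h5]
    calc _ ≤ |‖w‖ ^ 2 / r ^ 2 - ‖z‖ ^ 2 / r ^ 2| * r + ‖w - z‖ := by
          refine (norm_add_le _ _).trans (add_le_add ?_ ?_)
          · rw [norm_smul, hpr, Real.norm_eq_abs]; gcongr
          · rw [← Submodule.coe_norm, I.symm.norm_map]
      _ ≤ _ := by push_cast; linarith
  · exact I.toContinuousLinearEquiv.differentiable.comp
      (T.orthogonalProjectionOnto.differentiable.comp (differentiable_id.sub_const c))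
  · refine LipschitzWith.of_dist_le_mul fun y z => ?_
    simp only [ψ]
    rw [I.dist_map, dist_eq_norm, ← map_sub, sub_sub_sub_cancel_right, dist_eq_norm]
    exact T.orthogonalProjectionOnto.le_of_opNorm_le T.orthogonalProjectionOnto_norm_le _
  · have h1 : φ w - c = √(1 - ‖w‖ ^ 2 / r ^ 2) • (p - c) + (I.symm w : E) := by
      simp only [φ]; abel
    simp only [ψ]
    rw [h1, map_add, map_smul, hP0, smul_zero, zero_add,
      Submodule.orthogonalProjectionOnto_mem_subspace_eq_self, I.apply_symm_apply]
  · simp [φ]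
  · have hw : ‖w‖ < r := by simpa using hw
    have h1 : 0 < 1 - ‖w‖ ^ 2 / r ^ 2 := by
      rw [sub_pos, div_lt_one (by positivity)]; gcongr
    refine ⟨mem_embeddedSphere.2 ⟨?_, ?_⟩, ?_⟩
    · have : φ w - c = √(1 - ‖w‖ ^ 2 / r ^ 2) • (p - c) + (I.symm w : E) := by
        simp only [φ]; abel
      rw [this]
      exact Submodule.add_mem _ (Submodule.smul_mem _ _ hpJ) ((hT _).1 (I.symm w).2).1
    · have : φ w - c = √(1 - ‖w‖ ^ 2 / r ^ 2) • (p - c) + (I.symm w : E) := by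
        simp only [φ]; abel
      have h2 : ‖φ w - c‖ ^ 2 = r ^ 2 := by
        rw [this, norm_add_sq_real, inner_smul_left, real_inner_comm _ (p - c), hIp, norm_smul, hpr,
          ← Submodule.coe_norm, I.symm.norm_map, mul_pow, Real.norm_eq_abs, sq_abs,
          Real.sq_sqrt h1.le]
        field_simp; ring
      exact (sq_eq_sq₀ (norm_nonneg _) hr.le).1 h2
    · rw [hinner]; positivity
  · have h1 : √(1 - ‖ψ y‖ ^ 2 / r ^ 2) = inner ℝ (y - c) (p - c) / r ^ 2 := by
      rw [Real.sqrt_eq_iff_mul_self_eq_of_pos (by positivity)]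
      have := hnorm y hy
      field_simp
      linarith
    simp only [φ]
    rw [h1, add_assoc, ← hdecomp y hy]; abel

theorem IsGraphChart.continuous {p : E} {φ ψ} (h : IsGraphChart J c r d p φ ψ) : Continuous ψ :=
  h.differentiable.continuous

theorem IsGraphChart.image_ball {p : E} {φ ψ} (h : IsGraphChart J c r d p φ ψ) (hr : 0 < r) :
    φ '' Metric.ball 0 r = embeddedSphere J c r ∩ {y | 0 < inner ℝ (y - c) (p - c)} := by
  apply Set.Subset.antisymm
  · rintro _ ⟨w, hw, rfl⟩
    exact h.mapsTo w hw
  · rintro y ⟨hy, hpos⟩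
    refine ⟨ψ y, ?_, h.right_inv y hy hpos⟩
    have h1 := h.norm_sq y hy
    have hpos' : 0 < inner ℝ (y - c) (p - c) := hpos
    rw [mem_ball_zero_iff]
    refine lt_of_pow_lt_pow_left₀ 2 hr.le ?_
    have : r ^ 2 * ‖ψ y‖ ^ 2 < r ^ 2 * r ^ 2 := by nlinarith
    exact lt_of_mul_lt_mul_left this (by positivity)

theorem isSmoothSubmanifold_embeddedSphere [FiniteDimensional ℝ N] [FiniteDimensional ℝ E]
    (hr : 0 < r) (hd : Module.finrank ℝ N = d + 1) :
    IsSmoothSubmanifold d (embeddedSphere J c r) := by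
  intro p hp
  obtain ⟨φ, ψ, h⟩ := exists_isGraphChart hr hd hp
  refine ⟨Metric.ball 0 r, φ, ⟨Metric.isOpen_ball, h.contDiffOn, fun v hv => ?_,
    ⟨_, ?_, h.image_ball hr⟩, ⟨ψ, h.continuous.continuousOn, fun w _ => h.left_inv w⟩⟩,
    ⟨0, by simpa using hr, h.map_zero⟩⟩
  -- Differentiating `ψ ∘ φ = id` gives the differential of `φ` a left inverse.
  · have hφ : HasFDerivAt φ (fderiv ℝ φ v) v :=
      ((h.contDiffOn.differentiableOn (by simp)).differentiableAt
        (Metric.isOpen_ball.mem_nhds hv)).hasFDerivAt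
    have h1 := (h.differentiable (φ v)).hasFDerivAt.comp v hφ
    have h2 : ψ ∘ φ = id := funext h.left_inv
    rw [h2] at h1
    have h3 := h1.unique (hasFDerivAt_id v)
    intro a b hab
    have := congrArg (fderiv ℝ ψ (φ v)) hab
    rw [← ContinuousLinearMap.comp_apply, ← ContinuousLinearMap.comp_apply, h3] at this
    simpa using this
  · exact isOpen_lt continuous_const (by fun_prop)

end Chart

/-! ### Hausdorff measure of the sphere and its caps -/

section Measure

open Measure

theorem euclideanHausdorffMeasure_image_le {X Y : Type*} [EMetricSpace X] [MeasurableSpace X]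
    [BorelSpace X] [EMetricSpace Y] [MeasurableSpace Y] [BorelSpace Y] {f : X → Y} {K : ℝ≥0}
    {s : Set X} (h : LipschitzOnWith K f s) (d : ℕ) :
    (μHE[d] : Measure Y) (f '' s) ≤ (K : ℝ≥0∞) ^ d * μHE[d] s := by
  have := h.hausdorffMeasure_image_le (d := d) (by simp)
  simp only [euclideanHausdorffMeasure_def, Measure.smul_apply]
  rw [ENNReal.rpow_natCast] at this
  rw [ENNReal.smul_def, ENNReal.smul_def, smul_eq_mul, smul_eq_mul]
  calc _ ≤ _ := mul_le_mul_right this _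
    _ = _ := by ring

variable {N E : Type*} [NormedAddCommGroup N] [InnerProductSpace ℝ N]
  [NormedAddCommGroup E] [InnerProductSpace ℝ E] [MeasurableSpace E] [BorelSpace E]
  {J : N →ₗᵢ[ℝ] E} {c : E} {r : ℝ} {d : ℕ}

theorem euclideanHausdorffMeasure_embeddedSphere [MeasurableSpace N] [BorelSpace N] :
    μHE[d] (embeddedSphere J c r) = μHE[d] (Metric.sphere (0 : N) r) :=
  Isometry.euclideanHausdorffMeasure_image
    ((IsometryEquiv.addLeft c).isometry.comp J.isometry) _

variable [FiniteDimensional ℝ N] [FiniteDimensional ℝ E]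

/-- Within distance `r` of the pole the inner product with `p - c` is at least `r² / 2`, so the
projection satisfies `‖ψ y‖² ≤ 3/4 r²`. There the chart is `3`-Lipschitz, which costs `3 ^ d`. -/
theorem euclideanHausdorffMeasure_embeddedSphere_inter_closedBall_le (hr : 0 < r)
    (hd : Module.finrank ℝ N = d + 1) {p : E} (hp : p ∈ embeddedSphere J c r) {ρ : ℝ}
    (hρ : ρ ≤ r) :
    μHE[d] (embeddedSphere J c r ∩ Metric.closedBall p ρ) ≤
      3 ^ d * volume (Metric.closedBall (0 : EuclideanSpace ℝ (Fin d)) ρ) := by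
  obtain ⟨φ, ψ, h⟩ := exists_isGraphChart hr hd hp
  have hψp : ψ p = 0 := by rw [← h.map_zero, h.left_inv]
  have hpr := (mem_embeddedSphere.1 hp).2
  have hsub : embeddedSphere J c r ∩ Metric.closedBall p ρ ⊆
      φ '' ({w | ‖w‖ ^ 2 ≤ 3 / 4 * r ^ 2} ∩ Metric.closedBall 0 ρ) := by
    rintro y ⟨hy, hyp⟩
    have hyp : ‖y - p‖ ≤ ρ := by simpa [dist_eq_norm] using hyp
    have hyr := (mem_embeddedSphere.1 hy).2
    have h1 : ‖y - p‖ ^ 2 = 2 * r ^ 2 - 2 * inner ℝ (y - c) (p - c) := by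
      rw [← sub_sub_sub_cancel_right y p c, norm_sub_sq_real, hyr, hpr]; ring
    have h2 : ‖y - p‖ ^ 2 ≤ r ^ 2 := by gcongr; linarith
    have h3 : r ^ 2 / 2 ≤ inner ℝ (y - c) (p - c) := by linarith
    have hr2 : 0 < r ^ 2 := by positivity
    refine ⟨ψ y, ⟨?_, ?_⟩, h.right_inv y hy (by linarith)⟩
    · have h4 := h.norm_sq y hy
      have : r ^ 2 * ‖ψ y‖ ^ 2 ≤ r ^ 2 * (3 / 4 * r ^ 2) := by nlinarith
      exact le_of_mul_le_mul_left this hr2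
    · have := h.lipschitz.dist_le_mul y p
      rw [hψp, dist_zero_right, dist_eq_norm] at this
      rw [mem_closedBall_zero_iff]
      simpa using this.trans (by simpa using hyp)
  calc _ ≤ μHE[d] (φ '' ({w | ‖w‖ ^ 2 ≤ 3 / 4 * r ^ 2} ∩ Metric.closedBall 0 ρ)) :=
        measure_mono hsub
    _ ≤ 3 ^ d * μHE[d] ({w | ‖w‖ ^ 2 ≤ 3 / 4 * r ^ 2} ∩
          Metric.closedBall (0 : EuclideanSpace ℝ (Fin d)) ρ) := by
        simpa using euclideanHausdorffMeasure_image_le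
          (h.lipschitzOn.mono Set.inter_subset_left) d
    _ ≤ _ := by
        rw [EuclideanSpace.euclideanHausdorffMeasure_eq_volume]
        gcongr
        exact Set.inter_subset_right

/-- The `1`-Lipschitz projection cannot increase measure, and its image contains a nonempty open
set. -/
theorem euclideanHausdorffMeasure_embeddedSphere_inter_pos (hr : 0 < r)
    (hd : Module.finrank ℝ N = d + 1) {p : E} (hp : p ∈ embeddedSphere J c r) {U : Set E}
    (hU : IsOpen U) (hpU : p ∈ U) : 0 < μHE[d] (embeddedSphere J c r ∩ U) := by
  obtain ⟨φ, ψ, h⟩ := exists_isGraphChart hr hd hp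
  have hopen : IsOpen (Metric.ball 0 r ∩ φ ⁻¹' U) :=
    h.contDiffOn.continuousOn.isOpen_inter_preimage Metric.isOpen_ball hU
  have hne : (Metric.ball 0 r ∩ φ ⁻¹' U).Nonempty :=
    ⟨0, by simpa using hr, by simpa [h.map_zero] using hpU⟩
  have hsub : Metric.ball 0 r ∩ φ ⁻¹' U ⊆ ψ '' (embeddedSphere J c r ∩ U) :=
    fun w hw => ⟨φ w, ⟨(h.mapsTo w hw.1).1, hw.2⟩, h.left_inv w⟩
  calc 0 < volume (Metric.ball 0 r ∩ φ ⁻¹' U) := hopen.measure_pos _ hne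
    _ = μHE[d] (Metric.ball 0 r ∩ φ ⁻¹' U) := by
        rw [EuclideanSpace.euclideanHausdorffMeasure_eq_volume]
    _ ≤ μHE[d] (ψ '' (embeddedSphere J c r ∩ U)) := measure_mono hsub
    _ ≤ _ := by
        simpa using euclideanHausdorffMeasure_image_le
          (h.lipschitz.lipschitzOnWith (s := embeddedSphere J c r ∩ U)) d

theorem euclideanHausdorffMeasure_embeddedSphere_lt_top (hr : 0 < r)
    (hd : Module.finrank ℝ N = d + 1) : μHE[d] (embeddedSphere J c r) < ⊤ := by
  refine isCompact_embeddedSphere.measure_lt_top_of_nhdsWithin fun p hp => ?_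
  refine ⟨embeddedSphere J c r ∩ Metric.closedBall p r,
    inter_mem_nhdsWithin _ (Metric.closedBall_mem_nhds p hr), ?_⟩
  refine (euclideanHausdorffMeasure_embeddedSphere_inter_closedBall_le hr hd hp
    le_rfl).trans_lt ?_
  exact ENNReal.mul_lt_top (by simp) measure_closedBall_lt_top

end Measure

/-! ### Le Cam's two-point method -/

section TwoPoint

theorem lintegral_fin_prod_eq_prod {Ω : Type*} [MeasurableSpace Ω] (P : Measure Ω) [SigmaFinite P]
    {n : ℕ} {f : Fin n → Ω → ℝ≥0∞} (hf : ∀ i, Measurable (f i)) :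
    ∫⁻ X, ∏ i, f i (X i) ∂(Measure.pi fun _ : Fin n => P) = ∏ i, ∫⁻ y, f i y ∂P := by
  induction n with
  | zero => simp
  | succ n ih =>
    have hmp := (measurePreserving_piFinSuccAbove (fun _ : Fin (n + 1) => P) 0).symm
    rw [← hmp.lintegral_comp_emb (MeasurableEquiv.measurableEmbedding _)]
    simp only [MeasurableEquiv.piFinSuccAbove_symm_apply, Fin.insertNthEquiv,
      Fin.prod_univ_succ, Fin.insertNth_zero, Equiv.coe_fn_mk, Fin.cons_succ, Fin.cons_zero]
    rw [← ih (fun i => hf i.succ)]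
    have hm : Measurable fun X : Fin n → Ω => ∏ i, f (Fin.succ i) (X i) :=
      Finset.measurable_prod _ fun i _ => (hf (Fin.succ i)).comp (measurable_pi_apply i)
    exact lintegral_prod_mul (hf 0).aemeasurable hm.aemeasurable

theorem pi_withDensity {Ω : Type*} [MeasurableSpace Ω] (P : Measure Ω) [SigmaFinite P]
    {g : Ω → ℝ≥0∞} (hg : Measurable g) [SigmaFinite (P.withDensity g)] (n : ℕ) :
    (Measure.pi fun _ : Fin n => P.withDensity g) =
      (Measure.pi fun _ : Fin n => P).withDensity fun X => ∏ i, g (X i) := by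
  refine Measure.pi_eq (μ := fun _ : Fin n => P.withDensity g) fun s hs => ?_
  rw [withDensity_apply _ (MeasurableSet.univ_pi hs),
    ← lintegral_indicator (MeasurableSet.univ_pi hs)]
  have h : (Set.univ.pi s).indicator (fun X : Fin n → Ω => ∏ i, g (X i)) =
      fun X => ∏ i, (s i).indicator g (X i) := by
    funext X
    by_cases hX : X ∈ Set.univ.pi s
    · rw [Set.indicator_of_mem hX]
      exact Finset.prod_congr rfl fun i _ => (Set.indicator_of_mem (hX i trivial) _).symm
    · rw [Set.indicator_of_notMem hX]
      simp only [Set.mem_pi, not_forall] at hX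
      obtain ⟨i, -, hi⟩ := hX
      exact (Finset.prod_eq_zero (Finset.mem_univ i) (Set.indicator_of_notMem hi _)).symm
  rw [h, lintegral_fin_prod_eq_prod P fun i => hg.indicator (hs i)]
  exact Finset.prod_congr rfl fun i _ => by
    rw [lintegral_indicator (hs i), withDensity_apply _ (hs i)]

/-- For `g ≥ 1` this is `(g - 2)² ≥ 0`. It converts a second-moment bound into a lower bound on the
overlap `∫ min(1, g)`. -/
theorem le_min_one_add_sq_div_four (g : ℝ≥0∞) : g ≤ min 1 g + g ^ 2 / 4 := by
  rcases le_total g 1 with h | h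
  · rw [min_eq_right h]; exact le_self_add
  · rw [min_eq_left h]
    rcases eq_or_ne g ⊤ with rfl | hg
    · simp [ENNReal.top_div_of_ne_top]
    · lift g to ℝ≥0 using hg
      rw [show (4 : ℝ≥0∞) = ((4 : ℝ≥0) : ℝ≥0∞) by norm_num, ← ENNReal.coe_pow,
        ← ENNReal.coe_div (by norm_num), ← ENNReal.coe_one, ← ENNReal.coe_add, ENNReal.coe_le_coe,
        ← NNReal.coe_le_coe]
      push_cast
      nlinarith [sq_nonneg ((g : ℝ) - 2)]

/-- Le Cam's two-point bound, in terms of the second moment of the likelihood ratio. -/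
theorem ofReal_abs_sub_le_lintegral_add_lintegral_withDensity {Ω : Type*} [MeasurableSpace Ω]
    (P : Measure Ω) {g : Ω → ℝ≥0∞} (hg : Measurable g) (hg1 : ∫⁻ X, g X ∂P = 1)
    (hg2 : ∫⁻ X, g X ^ 2 ∂P ≤ 2) {T : Ω → ℝ} (hT : Measurable T) (a b : ℝ) :
    ENNReal.ofReal |a - b| / 2 ≤ ∫⁻ X, ENNReal.ofReal |T X - a| ∂P +
      ∫⁻ X, ENNReal.ofReal |T X - b| ∂(P.withDensity g) := by
  have hmeas : ∀ a : ℝ, Measurable fun X => ENNReal.ofReal |T X - a| := fun a => by fun_prop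
  have hmin : (1 / 2 : ℝ≥0∞) ≤ ∫⁻ X, min 1 (g X) ∂P := by
    have h1 : (1 : ℝ≥0∞) ≤ ∫⁻ X, min 1 (g X) ∂P + 1 / 2 := by
      calc (1 : ℝ≥0∞) = ∫⁻ X, g X ∂P := hg1.symm
        _ ≤ ∫⁻ X, (min 1 (g X) + g X ^ 2 / 4) ∂P :=
            lintegral_mono fun X => le_min_one_add_sq_div_four _
        _ = ∫⁻ X, min 1 (g X) ∂P + (∫⁻ X, g X ^ 2 ∂P) / 4 := by
            rw [lintegral_add_left (measurable_const.min hg)]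
            simp only [div_eq_mul_inv]
            rw [lintegral_mul_const _ (hg.pow_const 2)]
        _ ≤ ∫⁻ X, min 1 (g X) ∂P + 2 / 4 := by gcongr
        _ = _ := by
            congr 1
            rw [ENNReal.div_eq_div_iff] <;> norm_num
    have h2 : (1 : ℝ≥0∞) = 1 / 2 + 1 / 2 := (ENNReal.add_halves 1).symm
    exact (ENNReal.add_le_add_iff_right (a := 1 / 2) (by simp)).1 (h2.symm.trans_le h1)
  rw [lintegral_withDensity_eq_lintegral_mul _ hg (hmeas b), ← lintegral_add_left (hmeas a)]
  calc ENNReal.ofReal |a - b| / 2 = 1 / 2 * ENNReal.ofReal |a - b| := by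
        rw [div_eq_mul_inv, one_div, mul_comm]
    _ ≤ (∫⁻ X, min 1 (g X) ∂P) * ENNReal.ofReal |a - b| := by gcongr
    _ = ∫⁻ X, min 1 (g X) * ENNReal.ofReal |a - b| ∂P :=
        (lintegral_mul_const _ (measurable_const.min hg)).symm
    _ ≤ _ := lintegral_mono fun X => by
        calc min 1 (g X) * ENNReal.ofReal |a - b|
            ≤ min 1 (g X) * (ENNReal.ofReal |T X - a| + ENNReal.ofReal |T X - b|) := by
              gcongr
              rw [← ENNReal.ofReal_add (abs_nonneg _) (abs_nonneg _)]
              refine ENNReal.ofReal_le_ofReal ?_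
              rw [abs_sub_comm (T X) a]
              exact abs_sub_le _ _ _
          _ ≤ 1 * ENNReal.ofReal |T X - a| + g X * ENNReal.ofReal |T X - b| := by
              rw [mul_add]
              gcongr
              · exact min_le_left _ _
              · exact min_le_right _ _
          _ = _ := by rw [one_mul]; rfl

variable {D : ℕ}

/-- Monotonicity of `L^p` norms under a probability measure reduces every `p` to `p = 1`, so the
constant does not involve `p`. -/
theorem lintegral_le_risk {p : ℝ} (hp : 1 ≤ p) (n : ℕ) (P : Measure (EuclideanSpace ℝ (Fin D)))
    [IsProbabilityMeasure P] {T : (Fin n → EuclideanSpace ℝ (Fin D)) → ℝ} (hT : Measurable T)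
    (a : ℝ) :
    ∫⁻ X, ENNReal.ofReal |T X - a| ∂(Measure.pi fun _ : Fin n => P) ≤ risk p n P T a := by
  have h := eLpNorm'_le_eLpNorm'_of_exponent_le (f := fun X => T X - a) (p := 1) (q := p) one_pos hp
    (Measure.pi fun _ : Fin n => P) (hT.sub_const a).aestronglyMeasurable
  simp only [eLpNorm', ENNReal.rpow_one, one_div_one, Real.enorm_eq_ofReal_abs] at h
  refine h.trans_eq ?_
  rw [risk]
  congr 2
  funext X
  rw [ENNReal.ofReal_rpow_of_nonneg (abs_nonneg _) (by linarith)]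

/-- The second moment of the product likelihood ratio is the `n`-th power of the one-sample moment.
Both risks are below the supremum, so twice the supremum exceeds half the separation. -/
theorem ofReal_abs_sub_div_four_le_minimaxRisk {x : EuclideanSpace ℝ (Fin D)} {d : ℕ}
    {α β τ L fmin fmax R p : ℝ} (hp : 1 ≤ p) {n : ℕ} {P : Measure (EuclideanSpace ℝ (Fin D))}
    {f₀ f₁ : EuclideanSpace ℝ (Fin D) → ℝ} {g : EuclideanSpace ℝ (Fin D) → ℝ≥0∞}
    (hg : Measurable g) (h₀ : DensityModel x d α β τ L fmin fmax R P f₀)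
    (h₁ : DensityModel x d α β τ L fmin fmax R (P.withDensity g) f₁)
    (hg2 : (∫⁻ y, g y ^ 2 ∂P) ^ n ≤ 2) :
    ENNReal.ofReal |f₀ x - f₁ x| / 4 ≤ minimaxRisk x d α β τ L fmin fmax R p n := by
  have := h₀.isProbability
  have := h₁.isProbability
  refine le_iInf₂ fun T hT => ?_
  set B := ⨆ (P : Measure (EuclideanSpace ℝ (Fin D))) (f : EuclideanSpace ℝ (Fin D) → ℝ)
      (_ : DensityModel x d α β τ L fmin fmax R P f), risk p n P T (f x) with hB
  have hB₀ : risk p n P T (f₀ x) ≤ B := le_iSup₂_of_le P f₀ (le_iSup_of_le h₀ le_rfl)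
  have hB₁ : risk p n (P.withDensity g) T (f₁ x) ≤ B :=
    le_iSup₂_of_le _ f₁ (le_iSup_of_le h₁ le_rfl)
  have hG : Measurable fun X : Fin n → EuclideanSpace ℝ (Fin D) => ∏ i, g (X i) :=
    Finset.measurable_prod _ fun i _ => hg.comp (measurable_pi_apply i)
  have hg1 : ∫⁻ y, g y ∂P = 1 := by
    rw [← setLIntegral_univ, ← withDensity_apply _ MeasurableSet.univ, measure_univ]
  have key := ofReal_abs_sub_le_lintegral_add_lintegral_withDensity
    (Measure.pi fun _ : Fin n => P) hG
    (by rw [lintegral_fin_prod_eq_prod P fun _ => hg]; simp [hg1])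
    (by
      simp only [← Finset.prod_pow]
      rw [lintegral_fin_prod_eq_prod P fun _ => hg.pow_const 2]
      simpa using hg2) hT (f₀ x) (f₁ x)
  rw [← pi_withDensity P hg n] at key
  have h2 : ENNReal.ofReal |f₀ x - f₁ x| / 2 ≤ B * 2 := by
    rw [mul_two]
    exact key.trans (add_le_add ((lintegral_le_risk hp n P hT _).trans hB₀)
      ((lintegral_le_risk hp n _ hT _).trans hB₁))
  have h3 := ENNReal.div_le_of_le_mul h2
  refine le_trans (le_of_eq ?_) h3
  rw [div_eq_mul_inv, div_eq_mul_inv, div_eq_mul_inv, mul_assoc,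
    ← ENNReal.mul_inv (by simp) (by simp)]
  norm_num

end TwoPoint

/-! ### Membership of sphere densities in the statistical model -/

section Model

variable {D d : ℕ} {J : EuclideanSpace ℝ (Fin (d + 1)) →ₗᵢ[ℝ] EuclideanSpace ℝ (Fin D)}
  {c x : EuclideanSpace ℝ (Fin D)} {r : ℝ}

/-- The model reads its manifold off the measure, as the topological support. Positivity of the
density is what makes this the whole sphere. -/
theorem support_withDensity_volumeMeasure_embeddedSphere (hr : 0 < r)
    {f : EuclideanSpace ℝ (Fin D) → ℝ} (hf : Measurable f)
    (hpos : ∀ y ∈ embeddedSphere J c r, 0 < f y) :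
    ((volumeMeasure d (embeddedSphere J c r)).withDensity
      fun y => ENNReal.ofReal (f y)).support = embeddedSphere J c r := by
  have hmS : MeasurableSet (embeddedSphere J c r) :=
    isCompact_embeddedSphere.isClosed.measurableSet
  apply Set.Subset.antisymm
  · refine Measure.support_subset_of_isClosed isCompact_embeddedSphere.isClosed ?_
    refine (withDensity_absolutelyContinuous _ _).ae_le ?_
    exact ae_restrict_mem hmS
  · intro p hp
    rw [Measure.mem_support_iff_forall]
    intro U hU
    obtain ⟨V, hVU, hV, hpV⟩ := mem_nhds_iff.1 hU
    refine lt_of_lt_of_le ?_ (measure_mono hVU)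
    rw [pos_iff_ne_zero]
    intro h0
    rw [withDensity_apply_eq_zero hf.ennreal_ofReal, volumeMeasure,
      Measure.restrict_apply' hmS] at h0
    have := euclideanHausdorffMeasure_embeddedSphere_inter_pos (d := d) hr (by simp) hp hV hpV
    refine this.ne' (measure_mono_null ?_ h0)
    rintro y ⟨hyS, hyV⟩
    exact ⟨⟨by simpa using hpos y hyS, hyV⟩, hyS⟩

theorem densityModel_embeddedSphere (hr : 0 < r) {α β L fmin fmax R : ℝ}
    (hx : x ∈ embeddedSphere J c r)
    (hL : IsHolderWith (embeddedSphere J c r) (α + 1) L fun y => y)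
    {f : EuclideanSpace ℝ (Fin D) → ℝ} (hf : Measurable f)
    (hpos : ∀ y ∈ embeddedSphere J c r, 0 < f y)
    (hmin : ∀ y ∈ embeddedSphere J c r, fmin ≤ f y)
    (hmax : ∀ y ∈ embeddedSphere J c r, f y ≤ fmax)
    (hH : IsHolderWith (embeddedSphere J c r) β R f)
    (hprob : IsProbabilityMeasure ((volumeMeasure d (embeddedSphere J c r)).withDensity
      fun y => ENNReal.ofReal (f y))) :
    DensityModel x d α β r L fmin fmax R
      ((volumeMeasure d (embeddedSphere J c r)).withDensity fun y => ENNReal.ofReal (f y)) f := by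
  have hsupp := support_withDensity_volumeMeasure_embeddedSphere hr hf hpos
  refine ⟨hprob, ?_, hf, by rw [hsupp], by rwa [hsupp], by rwa [hsupp], by rwa [hsupp]⟩
  rw [hsupp]
  exact ⟨hx, isSmoothSubmanifold_embeddedSphere hr (by simp), isCompact_embeddedSphere,
    ofReal_le_reach_embeddedSphere hr ⟨x, hx⟩, hL⟩

/-- A function that is odd under the antipodal map integrates to zero over the sphere. -/
theorem integral_volumeMeasure_embeddedSphere_of_odd {ψ : EuclideanSpace ℝ (Fin D) → ℝ}
    (hψ : ∀ y, ψ ((2 : ℝ) • c - y) = -ψ y) :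
    ∫ y, ψ y ∂(volumeMeasure d (embeddedSphere J c r)) = 0 := by
  have hmS : MeasurableSet (embeddedSphere J c r) :=
    isCompact_embeddedSphere.isClosed.measurableSet
  let σ : EuclideanSpace ℝ (Fin D) ≃ᵢ EuclideanSpace ℝ (Fin D) :=
    IsometryEquiv.subLeft ((2 : ℝ) • c)
  have hσ : ∀ y, σ y = (2 : ℝ) • c - y := fun y => rfl
  have hpre : σ ⁻¹' (embeddedSphere J c r) = embeddedSphere J c r := by
    ext y
    have : σ y - c = -(y - c) := by rw [hσ, two_smul]; abel
    rw [Set.mem_preimage, mem_embeddedSphere, mem_embeddedSphere, this, norm_neg,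
      Submodule.neg_mem_iff]
  have hmp := (σ.measurePreserving_euclideanHausdorffMeasure d).restrict_preimage hmS
  rw [hpre] at hmp
  have h1 := hmp.integral_comp σ.toHomeomorph.measurableEmbedding ψ
  simp only [hσ, hψ, integral_neg] at h1
  rw [volumeMeasure]
  linarith

end Model

/-! ### The perturbation: size, oddness, and moments of the likelihood ratio -/

section LowerBound

variable {D d : ℕ} {J : EuclideanSpace ℝ (Fin (d + 1)) →ₗᵢ[ℝ] EuclideanSpace ℝ (Fin D)}
  {c x : EuclideanSpace ℝ (Fin D)} {r h : ℝ}

theorem exists_linearIsometry_euclideanSpace {m n : ℕ} (hmn : m ≤ n) :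
    Nonempty (EuclideanSpace ℝ (Fin m) →ₗᵢ[ℝ] EuclideanSpace ℝ (Fin n)) := by
  let b := (EuclideanSpace.basisFun (Fin m) ℝ)
  let v : Fin m → EuclideanSpace ℝ (Fin n) := fun i =>
    EuclideanSpace.basisFun (Fin n) ℝ (Fin.castLE hmn i)
  have hv : Orthonormal ℝ v :=
    (EuclideanSpace.basisFun (Fin n) ℝ).orthonormal.comp _ (Fin.castLE_injective hmn)
  refine ⟨(b.toBasis.constr ℝ v).isometryOfOrthonormal (v := b.toBasis)
    (by simp) ?_⟩
  have : (b.toBasis.constr ℝ v) ∘ b.toBasis = v := funext fun i => b.toBasis.constr_basis ℝ v i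
  rwa [this]

/-- The area of the `d`-sphere of radius `r`. -/
noncomputable def sphereArea (d : ℕ) (r : ℝ) : ℝ :=
  (Measure.euclideanHausdorffMeasure d
    (Metric.sphere (0 : EuclideanSpace ℝ (Fin (d + 1))) r)).toReal

theorem volumeMeasure_embeddedSphere_univ (hr : 0 < r) :
    volumeMeasure d (embeddedSphere J c r) Set.univ = ENNReal.ofReal (sphereArea d r) := by
  have h := euclideanHausdorffMeasure_embeddedSphere (d := d) (J := J) (c := c) (r := r)
  have hlt := euclideanHausdorffMeasure_embeddedSphere_lt_top (d := d) (J := J) (c := c) hr (by simp)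
  rw [volumeMeasure, Measure.restrict_apply_univ, sphereArea, ← h, ENNReal.ofReal_toReal hlt.ne]

theorem sphereArea_pos (d : ℕ) (hr : 0 < r) : 0 < sphereArea d r := by
  let J : EuclideanSpace ℝ (Fin (d + 1)) →ₗᵢ[ℝ] EuclideanSpace ℝ (Fin (d + 1)) := LinearIsometry.id
  have h := euclideanHausdorffMeasure_embeddedSphere (d := d) (J := J) (c := 0) (r := r)
  have hlt := euclideanHausdorffMeasure_embeddedSphere_lt_top (d := d) (J := J) (c := 0) hr (by simp)
  obtain ⟨w, hw⟩ := exists_norm_eq (EuclideanSpace ℝ (Fin (d + 1))) hr.le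
  have hp : w ∈ embeddedSphere J 0 r := ⟨w, by simpa using hw, by simp [J]⟩
  have hpos := euclideanHausdorffMeasure_embeddedSphere_inter_pos (d := d) hr (by simp) hp
    isOpen_univ (Set.mem_univ w)
  rw [Set.inter_univ, h] at hpos
  rw [h] at hlt
  exact ENNReal.toReal_pos hpos.ne' hlt.ne

theorem norm_adjoint_apply {N E : Type*} [NormedAddCommGroup N] [InnerProductSpace ℝ N]
    [CompleteSpace N] [NormedAddCommGroup E] [InnerProductSpace ℝ E] [CompleteSpace E]
    (J : N →ₗᵢ[ℝ] E) {y : E} (hy : y ∈ LinearMap.range J.toLinearMap) :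
    ‖J.toContinuousLinearMap.adjoint y‖ = ‖y‖ := by
  obtain ⟨w, rfl⟩ := hy
  have : J.toContinuousLinearMap.adjoint (J w) = w := by
    refine ext_inner_right ℝ fun z => ?_
    rw [ContinuousLinearMap.adjoint_inner_left]
    exact J.inner_map_map w z
  change ‖J.toContinuousLinearMap.adjoint (J w)‖ = ‖J w‖
  rw [this, J.norm_map]

theorem sub_mem_range_of_mem_embeddedSphere {y : EuclideanSpace ℝ (Fin D)}
    (hy : y ∈ embeddedSphere J c r) (hx : x ∈ embeddedSphere J c r) :
    y - x ∈ LinearMap.range J.toLinearMap := by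
  rw [← sub_sub_sub_cancel_right y x c]
  exact Submodule.sub_mem _ (mem_embeddedSphere.1 hy).1 (mem_embeddedSphere.1 hx).1

theorem antipode_mem (hx : x ∈ embeddedSphere J c r) :
    (2 : ℝ) • c - x ∈ embeddedSphere J c r := by
  rw [mem_embeddedSphere] at hx ⊢
  have : (2 : ℝ) • c - x - c = -(x - c) := by rw [two_smul]; abel
  rw [this, norm_neg, Submodule.neg_mem_iff]
  exact hx

variable (Φ : ContDiffBump (0 : EuclideanSpace ℝ (Fin (d + 1))))

theorem abs_bumpDiff_le_one (x x' y : EuclideanSpace ℝ (Fin D)) : |bumpDiff J Φ x x' h y| ≤ 1 := by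
  rw [bumpDiff, abs_le]
  constructor <;> linarith [Φ.nonneg (x := h⁻¹ • J.toContinuousLinearMap.adjoint (y - x)),
    Φ.nonneg (x := h⁻¹ • J.toContinuousLinearMap.adjoint (y - x')),
    Φ.le_one (x := h⁻¹ • J.toContinuousLinearMap.adjoint (y - x)),
    Φ.le_one (x := h⁻¹ • J.toContinuousLinearMap.adjoint (y - x'))]

theorem continuous_bumpDiff (x x' : EuclideanSpace ℝ (Fin D)) :
    Continuous (bumpDiff J Φ x x' h) := by
  unfold bumpDiff
  have := Φ.continuous
  fun_prop

theorem bumpDiff_antipode (y : EuclideanSpace ℝ (Fin D)) :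
    bumpDiff J Φ x ((2 : ℝ) • c - x) h ((2 : ℝ) • c - y) =
      -bumpDiff J Φ x ((2 : ℝ) • c - x) h y := by
  have h1 : (2 : ℝ) • c - y - x = -(y - ((2 : ℝ) • c - x)) := by abel
  have h2 : (2 : ℝ) • c - y - ((2 : ℝ) • c - x) = -(y - x) := by abel
  rw [bumpDiff, bumpDiff, h1, h2, map_neg, map_neg, smul_neg, smul_neg, Φ.neg, Φ.neg]
  ring

theorem bump_scaled_eq_zero (hh : 0 < h) {y z : EuclideanSpace ℝ (Fin D)}
    (hy : y ∈ embeddedSphere J c r) (hz : z ∈ embeddedSphere J c r)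
    (hyz : Φ.rOut * h ≤ ‖y - z‖) :
    Φ (h⁻¹ • J.toContinuousLinearMap.adjoint (y - z)) = 0 := by
  refine Φ.zero_of_le_dist ?_
  rw [dist_zero_right, norm_smul, norm_adjoint_apply J (sub_mem_range_of_mem_embeddedSphere hy hz),
    norm_inv, Real.norm_of_nonneg hh.le, ← div_eq_inv_mul, le_div_iff₀ hh]
  exact hyz

/-- The antipode is at distance `2r`, beyond the reach `r h ≤ r` of its bump, so only the bump at
`x` contributes. -/
theorem bumpDiff_self (hr : 0 < r) (hΦ : Φ.rOut = r) (hh : 0 < h) (hh1 : h ≤ 1)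
    (hx : x ∈ embeddedSphere J c r) :
    bumpDiff J Φ x ((2 : ℝ) • c - x) h x = 1 := by
  have h1 : x - ((2 : ℝ) • c - x) = (2 : ℝ) • (x - c) := by module
  have h2 : Φ.rOut * h ≤ ‖x - ((2 : ℝ) • c - x)‖ := by
    rw [h1, norm_smul, (mem_embeddedSphere.1 hx).2, hΦ, Real.norm_of_nonneg zero_le_two]
    nlinarith
  rw [bumpDiff, bump_scaled_eq_zero Φ hh hx (antipode_mem hx) h2, sub_self, map_zero, smul_zero,
    sub_zero]
  exact Φ.one_of_mem_closedBall (Metric.mem_closedBall_self Φ.rIn_pos.le)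

theorem bumpDiff_sq_le_indicator (hΦ : Φ.rOut = r) (hh : 0 < h)
    (hx : x ∈ embeddedSphere J c r) {y : EuclideanSpace ℝ (Fin D)}
    (hy : y ∈ embeddedSphere J c r) :
    bumpDiff J Φ x ((2 : ℝ) • c - x) h y ^ 2 ≤
      (Metric.closedBall x (r * h) ∪ Metric.closedBall ((2 : ℝ) • c - x) (r * h)).indicator
        (fun _ => (1 : ℝ)) y := by
  by_cases hmem : y ∈ Metric.closedBall x (r * h) ∪ Metric.closedBall ((2 : ℝ) • c - x) (r * h)
  · rw [Set.indicator_of_mem hmem, ← sq_abs]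
    exact pow_le_one₀ (abs_nonneg _) (abs_bumpDiff_le_one Φ _ _ _)
  · rw [Set.indicator_of_notMem hmem]
    simp only [Set.mem_union, Metric.mem_closedBall, dist_eq_norm, not_or, not_le] at hmem
    rw [bumpDiff, bump_scaled_eq_zero Φ hh hy hx (by rw [hΦ]; exact hmem.1.le),
      bump_scaled_eq_zero Φ hh hy (antipode_mem hx) (by rw [hΦ]; exact hmem.2.le)]
    simp

/-- The constant in the bound `∫ ψ² ≤ κ h ^ d` for the bump difference `ψ` at scale `h`. -/
noncomputable def capConst (d : ℕ) (r : ℝ) : ℝ :=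
  2 * (3 ^ d * (r ^ d * (volume (Metric.ball (0 : EuclideanSpace ℝ (Fin d)) 1)).toReal))

theorem capConst_pos (d : ℕ) (hr : 0 < r) : 0 < capConst d r := by
  have : 0 < (volume (Metric.ball (0 : EuclideanSpace ℝ (Fin d)) 1)).toReal :=
    ENNReal.toReal_pos (Metric.measure_ball_pos _ _ one_pos).ne' measure_ball_lt_top.ne
  unfold capConst
  positivity

theorem isFiniteMeasure_volumeMeasure_embeddedSphere (hr : 0 < r) :
    IsFiniteMeasure (volumeMeasure d (embeddedSphere J c r)) :=
  ⟨by rw [volumeMeasure_embeddedSphere_univ hr]; exact ENNReal.ofReal_lt_top⟩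

theorem integral_bumpDiff_sq_le (hr : 0 < r) (hΦ : Φ.rOut = r) (hh : 0 < h) (hh1 : h ≤ 1)
    (hx : x ∈ embeddedSphere J c r) :
    ∫ y, bumpDiff J Φ x ((2 : ℝ) • c - x) h y ^ 2 ∂(volumeMeasure d (embeddedSphere J c r)) ≤
      capConst d r * h ^ d := by
  have hmS : MeasurableSet (embeddedSphere J c r) :=
    isCompact_embeddedSphere.isClosed.measurableSet
  have := isFiniteMeasure_volumeMeasure_embeddedSphere (d := d) (J := J) (c := c) hr
  set A := Metric.closedBall x (r * h) ∪ Metric.closedBall ((2 : ℝ) • c - x) (r * h) with hA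
  have hAm : MeasurableSet A :=
    Metric.isClosed_closedBall.measurableSet.union Metric.isClosed_closedBall.measurableSet
  have hball : ∀ p ∈ embeddedSphere J c r,
      (volumeMeasure d (embeddedSphere J c r)).real (Metric.closedBall p (r * h)) ≤
        3 ^ d * (r ^ d * (volume (Metric.ball (0 : EuclideanSpace ℝ (Fin d)) 1)).toReal) *
          h ^ d := by
    intro p hp
    have h1 := euclideanHausdorffMeasure_embeddedSphere_inter_closedBall_le (d := d) hr (by simp) hp
      (ρ := r * h) (by nlinarith)
    rw [Measure.real, volumeMeasure, Measure.restrict_apply' hmS, Set.inter_comm]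
    refine (ENNReal.toReal_mono (ENNReal.mul_ne_top (by simp) measure_closedBall_lt_top.ne)
      h1).trans_eq ?_
    rw [Measure.addHaar_closedBall _ _ (by positivity), finrank_euclideanSpace_fin,
      ENNReal.toReal_mul, ENNReal.toReal_mul, ENNReal.toReal_pow,
      ENNReal.toReal_ofReal (by positivity), mul_pow]
    simp only [ENNReal.toReal_ofNat]
    ring
  calc _ ≤ ∫ y, A.indicator (fun _ => (1 : ℝ)) y ∂(volumeMeasure d (embeddedSphere J c r)) := by
        refine integral_mono_ae ?_ ((integrable_const _).indicator hAm) ?_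
        · refine Integrable.of_bound
            ((continuous_bumpDiff Φ _ _).pow 2).aestronglyMeasurable 1 (.of_forall fun y => ?_)
          rw [norm_pow, Real.norm_eq_abs]
          exact pow_le_one₀ (abs_nonneg _) (abs_bumpDiff_le_one Φ _ _ _)
        · exact (ae_restrict_mem hmS).mono fun y hy => bumpDiff_sq_le_indicator Φ hΦ hh hx hy
    _ = (volumeMeasure d (embeddedSphere J c r)).real A := by
        rw [integral_indicator_const _ hAm, smul_eq_mul, mul_one]
    _ ≤ _ := measureReal_union_le _ _
    _ ≤ _ := add_le_add (hball x hx) (hball _ (antipode_mem hx))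
    _ = _ := by unfold capConst; ring

theorem isProbabilityMeasure_uniform (hr : 0 < r) :
    IsProbabilityMeasure ((volumeMeasure d (embeddedSphere J c r)).withDensity
      fun _ => ENNReal.ofReal (sphereArea d r)⁻¹) := by
  have hA := sphereArea_pos d hr
  constructor
  rw [withDensity_const, Measure.smul_apply, volumeMeasure_embeddedSphere_univ hr, smul_eq_mul,
    ← ENNReal.ofReal_mul (by positivity), inv_mul_cancel₀ hA.ne', ENNReal.ofReal_one]

theorem integral_uniform (hr : 0 < r) (u : EuclideanSpace ℝ (Fin D) → ℝ) :
    ∫ y, u y ∂((volumeMeasure d (embeddedSphere J c r)).withDensity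
      fun _ => ENNReal.ofReal (sphereArea d r)⁻¹) =
      (sphereArea d r)⁻¹ * ∫ y, u y ∂(volumeMeasure d (embeddedSphere J c r)) := by
  have hA := sphereArea_pos d hr
  rw [withDensity_const, integral_smul_measure, ENNReal.toReal_ofReal (by positivity), smul_eq_mul]

/-- First and second moment of the likelihood ratio of the perturbed density with respect to the
uniform one. -/
theorem lintegral_likelihoodRatio (hr : 0 < r) (hΦ : Φ.rOut = r) (hh : 0 < h) (hh1 : h ≤ 1)
    (hx : x ∈ embeddedSphere J c r) {t : ℝ} (ht0 : 0 ≤ t) (ht1 : t ≤ 1) :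
    ∫⁻ y, ENNReal.ofReal (1 + t * bumpDiff J Φ x ((2 : ℝ) • c - x) h y)
      ∂((volumeMeasure d (embeddedSphere J c r)).withDensity
        fun _ => ENNReal.ofReal (sphereArea d r)⁻¹) = 1 ∧
    ∫⁻ y, ENNReal.ofReal (1 + t * bumpDiff J Φ x ((2 : ℝ) • c - x) h y) ^ 2
      ∂((volumeMeasure d (embeddedSphere J c r)).withDensity
        fun _ => ENNReal.ofReal (sphereArea d r)⁻¹) ≤
      ENNReal.ofReal (1 + t ^ 2 * ((sphereArea d r)⁻¹ * (capConst d r * h ^ d))) := by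
  have hA := sphereArea_pos d hr
  have := isProbabilityMeasure_uniform (d := d) (J := J) (c := c) hr
  set P := (volumeMeasure d (embeddedSphere J c r)).withDensity
        fun _ => ENNReal.ofReal (sphereArea d r)⁻¹ with hP
  set ψ := bumpDiff J Φ x ((2 : ℝ) • c - x) h with hψ
  have hψc : Continuous ψ := continuous_bumpDiff Φ _ _
  have hψ1 : ∀ y, |ψ y| ≤ 1 := abs_bumpDiff_le_one Φ _ _
  have hint : Integrable ψ P :=
    Integrable.of_bound hψc.aestronglyMeasurable 1 (.of_forall hψ1)
  have hint2 : Integrable (fun y => ψ y ^ 2) P := by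
    refine Integrable.of_bound (hψc.pow 2).aestronglyMeasurable 1 (.of_forall fun y => ?_)
    rw [norm_pow, Real.norm_eq_abs]
    exact pow_le_one₀ (abs_nonneg _) (hψ1 y)
  have hpos : ∀ y, 0 ≤ 1 + t * ψ y := fun y => by
    have := (abs_le.1 (hψ1 y)).1
    nlinarith
  have hzero : ∫ y, ψ y ∂P = 0 := by
    rw [hP, integral_uniform hr, integral_volumeMeasure_embeddedSphere_of_odd
      (fun y => bumpDiff_antipode Φ y), mul_zero]
  have hsq : ∫ y, ψ y ^ 2 ∂P ≤ (sphereArea d r)⁻¹ * (capConst d r * h ^ d) := by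
    rw [hP, integral_uniform hr]
    gcongr
    exact integral_bumpDiff_sq_le Φ hr hΦ hh hh1 hx
  constructor
  · have hi : Integrable (fun y => 1 + t * ψ y) P := (integrable_const _).add (hint.const_mul t)
    rw [← ofReal_integral_eq_lintegral_ofReal hi (.of_forall hpos),
      integral_add (integrable_const _) (hint.const_mul t), integral_const_mul,
      hzero]
    simp
  · have he : ∀ y, ENNReal.ofReal (1 + t * ψ y) ^ 2 =
        ENNReal.ofReal (1 + 2 * t * ψ y + t ^ 2 * ψ y ^ 2) := fun y => by
      rw [← ENNReal.ofReal_pow (hpos y)]; congr 1; ring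
    simp only [he]
    have hi1 : Integrable (fun y => 1 + 2 * t * ψ y) P :=
      (integrable_const _).add (hint.const_mul _)
    have hi2 : Integrable (fun y => 1 + 2 * t * ψ y + t ^ 2 * ψ y ^ 2) P :=
      hi1.add (hint2.const_mul _)
    rw [← ofReal_integral_eq_lintegral_ofReal hi2
      (.of_forall fun y => by
        have := sq_nonneg (1 + t * ψ y)
        simp only [Pi.zero_apply]
        linarith), integral_add hi1 (hint2.const_mul _),
      integral_add (integrable_const _) (hint.const_mul _), integral_const_mul, integral_const_mul,
      hzero]
    refine ENNReal.ofReal_le_ofReal ?_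
    simp only [integral_const, probReal_univ, smul_eq_mul]
    have : t ^ 2 * ∫ y, ψ y ^ 2 ∂P ≤ t ^ 2 * ((sphereArea d r)⁻¹ * (capConst d r * h ^ d)) := by
      gcongr
    linarith

end LowerBound

/-! ### Calibration of the scale and conclusion -/

theorem one_add_div_two_mul_pow_le_two {n : ℕ} (hn : 1 ≤ n) : (1 + 1 / (2 * (n : ℝ))) ^ n ≤ 2 := by
  have hn' : (0 : ℝ) < n := by exact_mod_cast hn
  have h1 : (1 + 1 / (2 * (n : ℝ))) ^ n ≤ Real.exp (1 / 2) := by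
    calc (1 + 1 / (2 * (n : ℝ))) ^ n ≤ (Real.exp (1 / (2 * (n : ℝ)))) ^ n := by
          gcongr
          linarith [Real.add_one_le_exp (1 / (2 * (n : ℝ)))]
      _ = Real.exp (1 / 2) := by
          rw [← Real.exp_nat_mul]; congr 1; field_simp
  have h2 : Real.exp (1 / 2) ^ 2 ≤ 2 ^ 2 := by
    rw [← Real.exp_nat_mul]
    norm_num
    linarith [Real.exp_one_lt_d9]
  exact h1.trans (le_of_sq_le_sq h2 (by norm_num))

/-- The minimax lower bound for a fixed sample size, from the uniform distribution on a sphere and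
its perturbation of height `a h ^ β` at scale `h = n ^ (-1 / (2 β + d))`. -/
theorem ofReal_le_rpow_mul_minimaxRisk {D d : ℕ} (hd : 1 ≤ d)
    {J : EuclideanSpace ℝ (Fin (d + 1)) →ₗᵢ[ℝ] EuclideanSpace ℝ (Fin D)}
    {c x : EuclideanSpace ℝ (Fin D)} {α β τ L fmin fmax R p a M : ℝ} (hτ : 0 < τ)
    (hx : x ∈ embeddedSphere J c τ) (hβ : 0 ≤ β) (hR : 0 < R) (hp : 1 ≤ p) (ha : 0 < a)
    (Φ : ContDiffBump (0 : EuclideanSpace ℝ (Fin (d + 1)))) (hΦ : Φ.rOut = τ)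
    (hL : IsHolderWith (embeddedSphere J c τ) (α + 1) L fun y => y)
    (hM : ∀ (x x' : EuclideanSpace ℝ (Fin D)) (h q b : ℝ), 0 < h → h ≤ 1 → 0 ≤ q →
      IsHolderWith (embeddedSphere J c τ) β (M * q / h ^ β)
        (fun y => b + q * bumpDiff J Φ x x' h y))
    (ha1 : a ≤ (sphereArea d τ)⁻¹ / 2) (ha2 : M * a ≤ R)
    (ha3 : a ^ 2 * (sphereArea d τ * capConst d τ) ≤ 1 / 2)
    (hfmin : fmin ≤ (sphereArea d τ)⁻¹ / 2) (hfmax : 3 / 2 * (sphereArea d τ)⁻¹ ≤ fmax)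
    {n : ℕ} (hn : 1 ≤ n) :
    ENNReal.ofReal (a / 4) ≤ ENNReal.ofReal ((n : ℝ) ^ (β / (2 * β + (d : ℝ)))) *
      minimaxRisk x d α β τ L fmin fmax R p n := by
  have hA := sphereArea_pos d hτ
  set m := sphereArea d τ with hm
  have hn1 : (1 : ℝ) ≤ n := by exact_mod_cast hn
  have hn0 : (0 : ℝ) < n := by linarith
  have hd1 : (1 : ℝ) ≤ d := by exact_mod_cast hd
  have hs : 0 < 2 * β + (d : ℝ) := by linarith
  -- The solution of `h ^ (2β + d) = 1 / n`, which balances `q ^ 2 * h ^ d` against the sample size.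
  set h : ℝ := (n : ℝ) ^ (-(1 / (2 * β + (d : ℝ)))) with hh
  have hh0 : 0 < h := by positivity
  have hh1 : h ≤ 1 := Real.rpow_le_one_of_one_le_of_nonpos hn1 (by
    rw [neg_nonpos]; positivity)
  have hhβ : h ^ β = ((n : ℝ) ^ (β / (2 * β + (d : ℝ))))⁻¹ := by
    rw [hh, ← Real.rpow_mul hn0.le, ← Real.rpow_neg hn0.le]; congr 1; ring
  have hhβ0 : 0 < h ^ β := by positivity
  have hhβ1 : h ^ β ≤ 1 := Real.rpow_le_one hh0.le hh1 hβ
  have hhn : (h ^ β) ^ 2 * h ^ d = 1 / n := by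
    rw [hh, ← Real.rpow_natCast, ← Real.rpow_natCast, ← Real.rpow_mul hn0.le,
      ← Real.rpow_mul hn0.le, ← Real.rpow_mul hn0.le, ← Real.rpow_add hn0,
      show (1 : ℝ) / n = (n : ℝ) ^ (-1 : ℝ) by rw [Real.rpow_neg_one, one_div]]
    congr 1
    push_cast
    field_simp
    ring
  set q := a * h ^ β with hq
  have hq0 : 0 < q := by positivity
  have hqa : q ≤ a := mul_le_of_le_one_right ha.le hhβ1
  set x' := (2 : ℝ) • c - x with hx'
  -- The perturbation relative to the uniform level `m⁻¹`: the likelihood ratio is `1 + t ψ`.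
  set t := q * m with ht
  have ht0 : 0 ≤ t := by positivity
  have ht1 : t ≤ 1 := by
    have : q * m ≤ m⁻¹ / 2 * m := by gcongr; linarith
    have h2 : m⁻¹ / 2 * m = 1 / 2 := by field_simp
    linarith
  have hψ1 : ∀ y, |bumpDiff J Φ x x' h y| ≤ 1 := abs_bumpDiff_le_one Φ x x'
  set μ := volumeMeasure d (embeddedSphere J c τ) with hμ
  let f₀ : EuclideanSpace ℝ (Fin D) → ℝ := fun _ => m⁻¹
  let f₁ : EuclideanSpace ℝ (Fin D) → ℝ := fun y => m⁻¹ + q * bumpDiff J Φ x x' h y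
  let g : EuclideanSpace ℝ (Fin D) → ℝ≥0∞ := fun y =>
    ENNReal.ofReal (1 + t * bumpDiff J Φ x x' h y)
  have hψc : Continuous (bumpDiff J Φ x x' h) := continuous_bumpDiff Φ x x'
  have hf₁m : Measurable f₁ := (continuous_const.add (continuous_const.mul hψc)).measurable
  have hgm : Measurable g :=
    (continuous_const.add (continuous_const.mul hψc)).measurable.ennreal_ofReal
  have hm0 : 0 < m⁻¹ := by positivity
  have hf₁lo : ∀ y, m⁻¹ / 2 ≤ f₁ y := fun y => by
    have h1 := (abs_le.1 (hψ1 y)).1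
    simp only [f₁]
    nlinarith
  have hf₁hi : ∀ y, f₁ y ≤ 3 / 2 * m⁻¹ := fun y => by
    have h1 := (abs_le.1 (hψ1 y)).2
    simp only [f₁]
    nlinarith
  obtain ⟨hg1, hg2⟩ := lintegral_likelihoodRatio (d := d) Φ hτ hΦ hh0 hh1 hx ht0 ht1
  have hwd : (μ.withDensity fun y => ENNReal.ofReal (f₀ y)).withDensity g =
      μ.withDensity fun y => ENNReal.ofReal (f₁ y) := by
    rw [← withDensity_mul _ (by fun_prop) hgm]
    congr 1
    funext y
    simp only [Pi.mul_apply, f₀, f₁, g]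
    rw [← ENNReal.ofReal_mul hm0.le]
    congr 1
    rw [ht]; field_simp
  have hP₀ : DensityModel x d α β τ L fmin fmax R
      (μ.withDensity fun y => ENNReal.ofReal (f₀ y)) f₀ := by
    refine densityModel_embeddedSphere hτ hx hL measurable_const (fun _ _ => hm0)
      (fun _ _ => ?_) (fun _ _ => ?_) ?_ (isProbabilityMeasure_uniform hτ)
    · simp only [f₀]; linarith
    · simp only [f₀]; linarith
    -- Height zero gives the constant density with Hölder coefficient `0`.
    · have := hM x x' h 0 m⁻¹ hh0 hh1 le_rfl
      simp only [zero_mul, add_zero, mul_zero, zero_div] at this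
      exact this.mono hR.le
  have hprob : IsProbabilityMeasure (μ.withDensity fun y => ENNReal.ofReal (f₁ y)) := by
    rw [← hwd]
    exact ⟨by rw [withDensity_apply _ MeasurableSet.univ, setLIntegral_univ]; exact hg1⟩
  have hP₁ : DensityModel x d α β τ L fmin fmax R
      ((μ.withDensity fun y => ENNReal.ofReal (f₀ y)).withDensity g) f₁ := by
    rw [hwd]
    refine densityModel_embeddedSphere hτ hx hL hf₁m
      (fun y _ => lt_of_lt_of_le (by positivity) (hf₁lo y)) (fun y _ => hfmin.trans (hf₁lo y))
      (fun y _ => (hf₁hi y).trans hfmax) ?_ hprob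
    refine (hM x x' h q m⁻¹ hh0 hh1 hq0.le).mono (le_trans (le_of_eq ?_) ha2)
    rw [hq]; field_simp
  have hpow : (∫⁻ y, g y ^ 2 ∂(μ.withDensity fun y => ENNReal.ofReal (f₀ y))) ^ n ≤ 2 := by
    have hb : t ^ 2 * (m⁻¹ * (capConst d τ * h ^ d)) ≤ 1 / (2 * (n : ℝ)) := by
      calc _ = a ^ 2 * (m * capConst d τ) * ((h ^ β) ^ 2 * h ^ d) := by
            rw [ht, hq]; field_simp
        _ ≤ 1 / 2 * (1 / n) := by rw [hhn]; gcongr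
        _ = _ := by field_simp
    calc _ ≤ ENNReal.ofReal (1 + 1 / (2 * (n : ℝ))) ^ n := by
          gcongr
          exact hg2.trans (ENNReal.ofReal_le_ofReal (by linarith))
      _ = ENNReal.ofReal ((1 + 1 / (2 * (n : ℝ))) ^ n) := by
          rw [ENNReal.ofReal_pow (by positivity)]
      _ ≤ ENNReal.ofReal 2 := ENNReal.ofReal_le_ofReal (one_add_div_two_mul_pow_le_two hn)
      _ = 2 := by simp
  have key := ofReal_abs_sub_div_four_le_minimaxRisk hp hgm hP₀ hP₁ hpow
  have hdiff : |f₀ x - f₁ x| = q := by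
    simp only [f₀, f₁]
    rw [hx', bumpDiff_self Φ hτ hΦ hh0 hh1 hx, mul_one, sub_add_cancel_left, abs_neg,
      abs_of_pos hq0]
  rw [hdiff] at key
  calc ENNReal.ofReal (a / 4)
      = ENNReal.ofReal ((n : ℝ) ^ (β / (2 * β + (d : ℝ)))) * (ENNReal.ofReal q / 4) := by
        rw [show (4 : ℝ≥0∞) = ENNReal.ofReal 4 by simp, ← ENNReal.ofReal_div_of_pos (by norm_num),
          ← ENNReal.ofReal_mul (by positivity), hq, hhβ]
        congr 1
        field_simp
    _ ≤ _ := by gcongr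

theorem exists_mem_embeddedSphere {D d : ℕ} {r : ℝ} (hr : 0 < r)
    (J : EuclideanSpace ℝ (Fin (d + 1)) →ₗᵢ[ℝ] EuclideanSpace ℝ (Fin D))
    (x : EuclideanSpace ℝ (Fin D)) : ∃ c, x ∈ embeddedSphere J c r := by
  obtain ⟨w, hw⟩ := exists_norm_eq (EuclideanSpace ℝ (Fin (d + 1))) hr.le
  exact ⟨x - J w, w, by simpa using hw, by simp⟩

end ManifoldDensity

theorem theorem3p2 (d : ℕ) (hd : 1 ≤ d) (τ : ℝ) (hτ : 0 < τ) :
    ∃ (fmin₀ fmax₀ : ℝ) (L₀ : ℝ → ℝ) (C : ℝ → ℝ → ℝ),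
      0 < fmin₀ ∧ (∀ β R : ℝ, 0 ≤ β → 0 < R → 0 < C β R) ∧
      ∀ (D : ℕ) (x : EuclideanSpace ℝ (Fin D)) (α β R L fmin fmax p : ℝ),
        d + 1 ≤ D → 0 ≤ α → 0 ≤ β → 0 < R → 0 < L → 0 ≤ fmin → fmin < fmax → 1 ≤ p →
        L₀ α ≤ L → fmax₀ ≤ fmax → fmin ≤ fmin₀ →
        ENNReal.ofReal (C β R) ≤
          Filter.liminf (fun n : ℕ =>
            ENNReal.ofReal ((n : ℝ) ^ (β / (2 * β + (d : ℝ)))) *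
              ManifoldDensity.minimaxRisk x d α β τ L fmin fmax R p n) Filter.atTop := by
  open ManifoldDensity in
  -- Outer radius `τ` and `h ≤ 1` keep each bump within distance `τ` of its centre, where the cap
  -- estimate applies.
  let Φ : ContDiffBump (0 : EuclideanSpace ℝ (Fin (d + 1))) := ⟨τ / 2, τ, by linarith, by linarith⟩
  have hA := sphereArea_pos d hτ
  have hκ := capConst_pos d hτ
  -- The threshold is a function of all real `α`; for negative `α` it takes the idle value `0`.
  have hLex : ∀ α : ℝ, ∃ L₀ : ℝ, 0 ≤ α → ∀ (D : ℕ)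
      (J : EuclideanSpace ℝ (Fin (d + 1)) →ₗᵢ[ℝ] EuclideanSpace ℝ (Fin D))
      (c : EuclideanSpace ℝ (Fin D)),
      IsHolderWith (embeddedSphere J c τ) (α + 1) L₀ (fun y => y) := fun α => by
    by_cases hα : 0 ≤ α
    · obtain ⟨L₀, h⟩ := exists_isHolderWith_id d hd hτ (show 0 ≤ α + 1 by linarith)
      exact ⟨L₀, fun _ => h⟩
    · exact ⟨0, fun h => absurd h hα⟩
  choose L₀ hL₀ using hLex
  have hMex : ∀ β : ℝ, ∃ M : ℝ, 0 < M ∧ (0 ≤ β → ∀ (D : ℕ)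
      (J : EuclideanSpace ℝ (Fin (d + 1)) →ₗᵢ[ℝ] EuclideanSpace ℝ (Fin D))
      (c x x' : EuclideanSpace ℝ (Fin D)) (h q b : ℝ), 0 < h → h ≤ 1 → 0 ≤ q →
      IsHolderWith (embeddedSphere J c τ) β (M * q / h ^ β)
        (fun y => b + q * bumpDiff J Φ x x' h y)) := fun β => by
    by_cases hβ : 0 ≤ β
    · obtain ⟨M, hM, h⟩ := exists_isHolderWith_bumpDiff d hd hτ hβ Φ.contDiff Φ.hasCompactSupport
      exact ⟨M, hM, fun _ => h⟩
    · exact ⟨1, one_pos, fun h => absurd h hβ⟩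
  choose M hM0 hM using hMex
  -- The three terms keep the density between half and three halves of the uniform level, its Hölder
  -- coefficient below `R`, and the chi-square distance below `1 / (2n)`.
  let a : ℝ → ℝ → ℝ := fun β R => min ((sphereArea d τ)⁻¹ / 2)
    (min (R / M β) (√(1 / (2 * (sphereArea d τ * capConst d τ)))))
  have ha : ∀ β R : ℝ, 0 < R → 0 < a β R := fun β R hR => by
    have := hM0 β
    exact lt_min (by positivity) (lt_min (by positivity) (by positivity))
  refine ⟨(sphereArea d τ)⁻¹ / 2, 3 / 2 * (sphereArea d τ)⁻¹, L₀, fun β R => a β R / 4,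
    by positivity, fun β R _ hR => by linarith [ha β R hR], ?_⟩
  intro D x α β R L fmin fmax p hD hα hβ hR _ _ _ hp hL hfmax hfmin
  obtain ⟨J⟩ := exists_linearIsometry_euclideanSpace hD
  obtain ⟨c, hx⟩ := exists_mem_embeddedSphere hτ J x
  refine Filter.le_liminf_of_le (by isBoundedDefault) ?_
  filter_upwards [Filter.eventually_ge_atTop 1] with n hn
  refine ofReal_le_rpow_mul_minimaxRisk hd hτ hx hβ hR hp (ha β R hR) Φ rfl
    ((hL₀ α hα D J c).mono hL) (hM β hβ D J c) (min_le_left _ _) ?_ ?_ hfmin hfmax hn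
  · have h1 : a β R ≤ R / M β := (min_le_right _ _).trans (min_le_left _ _)
    rw [le_div_iff₀ (hM0 β)] at h1
    linarith
  · have h1 : a β R ≤ √(1 / (2 * (sphereArea d τ * capConst d τ))) :=
      (min_le_right _ _).trans (min_le_right _ _)
    have h2 : a β R ^ 2 ≤ 1 / (2 * (sphereArea d τ * capConst d τ)) := by
      rw [← Real.sq_sqrt (show 0 ≤ 1 / (2 * (sphereArea d τ * capConst d τ)) by positivity)]
      have := (ha β R hR).le
      gcongr
    calc _ ≤ 1 / (2 * (sphereArea d τ * capConst d τ)) * (sphereArea d τ * capConst d τ) := by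
          gcongr
      _ = 1 / 2 := by field_simp
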